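/- Let $S$ be a closed connected smooth surface of negative Euler characteristic. For each $n\in\mathbb N$ let $S$ carry a complex structure compatible with its smooth structure, let $\sigma_n$ be the hyperbolic metric in its conformal class, and let $q_n$ be a holomorphic cubic differential for it. Let $h_n=e^{u_n}\sigma_n$ be the Blaschke metric of the hyperbolic affine sphere with conformal class $[\sigma_n]$ and Pick differential $q_n$; that is, in any local complex coordinate $z$, writing $h_n=e^{\psi}|dz|^2$, the metric $h_n$ is the Blaschke metric of a local affine sphere immersion $f$ into $\mathbb R^3$ with affine normal $f$ and $f_{zz}=\psi_z f_z+q_n e^{-\psi}f_{\bar z}$. Put $$\mathcal F_n=\tfrac32\Big(u_n-\tfrac13\log\frac{2|q_n|^2}{\sigma_n^3}\Big),\qquad \|q_n\|=\int_S|q_n|^{2/3},$$ so that $\|q_n\|$ is the area of the flat metric $|q_n|^{2/3}$ and $\mathcal F_n$ is, up to the factor $\tfrac32$, the difference of the logarithmic densities of $h_n$ and $2^{1/3}|q_n|^{2/3}$. Let $S'\subset S$ be an open subsurface, endowed with a compatible complex structure for which it is a compact Riemann surface $X$ with finitely many punctures (for instance a $\pi_1$-injective subsurface of negative Euler characteristic,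 with its boundary curves viewed as punctures), and let $\tilde q$ be a meromorphic cubic differential on $X$, with poles at most at the punctures, such that $|\tilde q|^{2/3}$ has finite area. Assume that, as tensors, $|q_n|^{2/3}/\|q_n\|\to|\tilde q|^{2/3}$ uniformly on compact subsets of $S'$, and that $\|q_n\|\to\infty$. Fix $\epsilon>0$ and let $p\in S'$ be at $|\tilde q|^{2/3}$-distance (in $X$) at least $\epsilon$ from all zeros and poles of $\tilde q$. Then there exist $n_0\in\mathbb N$, a constant $B>0$ and a sequence $d_n\to+\infty$ such that for every $n\ge n_0$ $$\mathcal F_n(p)\le\frac{B}{\cosh(d_n/2)}.$$ Moreover $d_n$ can be chosen so that $d_n\ge c\sqrt{\|q_n\|}$ for all $n\ge n_0$, with a constant $c>0$; thus $\mathcal F_n(p)$ is bounded above by a quantity that decays exponentially in $\sqrt{\|q_n\|}$. -/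

import Mathlib

open Filter Topology MeasureTheory
open scoped ContDiff Manifold ENNReal ComplexConjugate

noncomputable section

/-- A Riemann surface structure on a topological space: a set of complex charts which cover the
space and have holomorphic transition maps. (An explicit object, because one surface will carry a
sequence of different complex structures.) -/
structure RiemannSurfaceStructure (X : Type*) [TopologicalSpace X] where
  charts : Set (OpenPartialHomeomorph X ℂ)
  cover : ∀ x : X, ∃ φ ∈ charts, x ∈ φ.source
  holomorphic : ∀ φ ∈ charts, ∀ ψ ∈ charts,
    DifferentiableOn ℂ (ψ ∘ φ.symm) (φ.symm.trans ψ).source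

namespace RiemannSurfaceStructure

variable {X : Type*} [TopologicalSpace X]

/-- A chosen complex chart around `x`. -/
def chart (R : RiemannSurfaceStructure X) (x : X) : OpenPartialHomeomorph X ℂ :=
  (R.cover x).choose

lemma chart_mem (R : RiemannSurfaceStructure X) (x : X) : R.chart x ∈ R.charts :=
  (R.cover x).choose_spec.1

lemma mem_chart_source (R : RiemannSurfaceStructure X) (x : X) : x ∈ (R.chart x).source :=
  (R.cover x).choose_spec.2

/-- The complex structure is compatible with the given smooth structure of a surface: its charts
are smooth charts. -/
def IsCompatible {S : Type*} [TopologicalSpace S] [ChartedSpace ℂ S]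
    (R : RiemannSurfaceStructure S) : Prop :=
  R.charts ⊆ IsManifold.maximalAtlas 𝓘(ℝ, ℂ) ∞ S

end RiemannSurfaceStructure

/-- A meromorphic cubic differential, holomorphic off the set `P`. In a chart `φ` with coordinate
`z` it reads `coeff φ z dz³`; values of the coefficients at points of `P` carry no meaning. -/
structure CubicDifferential {X : Type*} [TopologicalSpace X] (R : RiemannSurfaceStructure X)
    (P : Set X) where
  coeff : OpenPartialHomeomorph X ℂ → ℂ → ℂ
  meromorphic : ∀ φ ∈ R.charts, MeromorphicOn (coeff φ) φ.target
  holomorphic : ∀ φ ∈ R.charts, ∀ z ∈ φ.target, φ.symm z ∉ P → AnalyticAt ℂ (coeff φ) z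
  transform : ∀ φ ∈ R.charts, ∀ ψ ∈ R.charts, ∀ z ∈ (φ.symm.trans ψ).source, φ.symm z ∉ P →
    coeff φ z = coeff ψ (ψ (φ.symm z)) * deriv (ψ ∘ φ.symm) z ^ 3

/-- Holomorphic cubic differentials. -/
abbrev HolomorphicCubicDifferential {X : Type*} [TopologicalSpace X]
    (R : RiemannSurfaceStructure X) := CubicDifferential R ∅

namespace CubicDifferential

variable {X : Type*} [TopologicalSpace X] {R : RiemannSurfaceStructure X} {P : Set X}

/-- The order of `q` at `x`: positive at zeros, negative at poles, zero elsewhere. -/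
def order (q : CubicDifferential R P) (x : X) : WithTop ℤ :=
  meromorphicOrderAt (q.coeff (R.chart x)) (R.chart x x)

/-- The flat metric `|q|^(2/3)` pulled back by a map `g : E → X`, as a quadratic form: its value at
the point `e` on the vector `v`. In a coordinate `z` this is `|q(z)|^(2/3) |dz|²`. -/
def flatMetric {E : Type*} [NormedAddCommGroup E] [NormedSpace ℝ E]
    (q : CubicDifferential R P) (g : E → X) (e v : E) : ℝ :=
  ‖q.coeff (R.chart (g e)) (R.chart (g e) (g e))‖ ^ (2 / 3 : ℝ) *
    ‖fderiv ℝ (R.chart (g e) ∘ g) e v‖ ^ 2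

/-- The area of the flat metric `|q|^(2/3)`: the supremum of the areas of finite disjoint unions of
measurable sets, each of which is contained in one chart. -/
def area (q : CubicDifferential R P) : ℝ≥0∞ :=
  ⨆ (k : ℕ) (φ : Fin k → OpenPartialHomeomorph X ℂ) (A : Fin k → Set ℂ)
    (_ : ∀ i, φ i ∈ R.charts ∧ MeasurableSet (A i) ∧ A i ⊆ (φ i).target)
    (_ : Pairwise fun i j => Disjoint ((φ i).symm '' A i) ((φ j).symm '' A j)),
    ∑ i, ∫⁻ z in A i, ‖q.coeff (φ i) z‖ₑ ^ (2 / 3 : ℝ)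

/-- `‖q‖`, the area of `|q|^(2/3)` as a real number. -/
def mass (q : CubicDifferential R P) : ℝ := q.area.toReal

/-- The `|q|^(2/3)`-length of a path parametrized by `[0,1]`. -/
def pathLength (q : CubicDifferential R P) (γ : ℝ → X) : ℝ≥0∞ :=
  ∫⁻ t in Set.Icc (0 : ℝ) 1, ENNReal.ofReal (√(q.flatMetric γ t 1))

end CubicDifferential

/-- Continuous paths on `[0,1]` which are continuously differentiable off a finite set of times. -/
def IsPiecewiseC1Path {X : Type*} [TopologicalSpace X] (R : RiemannSurfaceStructure X)
    (γ : ℝ → X) : Prop :=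
  ContinuousOn γ (Set.Icc 0 1) ∧ ∃ T : Set ℝ, T.Finite ∧ ∀ t ∈ Set.Icc (0 : ℝ) 1 \ T,
    ∀ φ ∈ R.charts, γ t ∈ φ.source → ContDiffAt ℝ 1 (φ ∘ γ) t

/-- The `|q|^(2/3)`-distance of two points: the infimum of the lengths of paths joining them. -/
def CubicDifferential.flatDist {X : Type*} [TopologicalSpace X] {R : RiemannSurfaceStructure X}
    {P : Set X} (q : CubicDifferential R P) (x y : X) : ℝ≥0∞ :=
  ⨅ (γ : ℝ → X) (_ : IsPiecewiseC1Path R γ ∧ γ 0 = x ∧ γ 1 = y), q.pathLength γ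

/-- A hyperbolic metric in the conformal class of `R`: in a chart `φ` it reads
`density φ z |dz|²`, and its curvature `-Δ(log density) / (2 density)` is `-1`. -/
structure HyperbolicMetric {X : Type*} [TopologicalSpace X] (R : RiemannSurfaceStructure X) where
  density : OpenPartialHomeomorph X ℂ → ℂ → ℝ
  pos : ∀ φ ∈ R.charts, ∀ z ∈ φ.target, 0 < density φ z
  smooth : ∀ φ ∈ R.charts, ContDiffOn ℝ ∞ (density φ) φ.target
  transform : ∀ φ ∈ R.charts, ∀ ψ ∈ R.charts, ∀ z ∈ (φ.symm.trans ψ).source,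
    density φ z = density ψ (ψ (φ.symm z)) * ‖deriv (ψ ∘ φ.symm) z‖ ^ 2
  curvature : ∀ φ ∈ R.charts, ∀ z ∈ φ.target,
    - Laplacian.laplacian (fun w => Real.log (density φ w)) z / (2 * density φ z) = -1

/-- `f : U → ℝ³` is a hyperbolic affine sphere centred at the origin, with affine normal `ξ = f`,
Blaschke metric `h` and Blaschke connection `∇_X Y = D_X Y + Γ(X, Y)`:
`D_X (f_* Y) = f_* (∇_X Y) + h(X, Y) f`, where `h` is positive definite and
`det(f_* X, f_* Y, f)²` is the Gram determinant of `X, Y` for `h`. (For `ξ = f` the other structure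
equation, `D_X ξ = f_* X`, holds automatically: the shape operator is `-1` and `τ = 0`.) -/
structure IsHyperbolicAffineSphere (U : Set ℂ) (f : ℂ → Fin 3 → ℝ) (h : ℂ → ℂ → ℂ → ℝ)
    (Γ : ℂ → ℂ → ℂ → ℂ) : Prop where
  smooth : ContDiffOn ℝ ∞ f U
  structure_eq : ∀ z ∈ U, ∀ X Y : ℂ,
    fderiv ℝ (fun w => fderiv ℝ f w Y) z X = fderiv ℝ f z (Γ z X Y) + h z X Y • f z
  pos : ∀ z ∈ U, ∀ X : ℂ, X ≠ 0 → 0 < h z X X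
  volume : ∀ z ∈ U, ∀ X Y : ℂ,
    (Matrix.of ![fderiv ℝ f z X, fderiv ℝ f z Y, f z]).det ^ 2 =
      h z X X * h z Y Y - h z X Y ^ 2

/-- The `∂/∂z̄`-component of `∇_{∂/∂z} ∂/∂z` for the complex-bilinear extension of a connection with
Christoffel symbols `Γ`, where `∂/∂z = (∂/∂x - i ∂/∂y) / 2` and a real vector `v` is
`v ∂/∂z + v̄ ∂/∂z̄`. The Levi-Civita connection of a conformal metric does not contribute to this
component, so for a Blaschke connection it is the component of the Pick form. -/
def pickComponent (Γ : ℂ → ℂ → ℂ) : ℂ :=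
  (conj (Γ 1 1) - conj (Γ Complex.I Complex.I) - 2 * Complex.I * conj (Γ 1 Complex.I)) / 4

/-- `e^u σ` is the Blaschke metric of an affine sphere with Pick differential `q`: around every
point, in every chart with coordinate `z`, there is a hyperbolic affine sphere whose Blaschke metric
is `e^ψ |dz|² = e^u σ` and for which the `∂/∂z̄`-component of `∇_{∂/∂z} ∂/∂z` is `q e^(-ψ)`, that is
`f_zz = ψ_z f_z + q e^(-ψ) f_z̄`. (An equivariant affine sphere defined on the universal cover gives
such local ones.) -/
def IsBlaschke {X : Type*} [TopologicalSpace X] {R : RiemannSurfaceStructure X}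
    (q : HolomorphicCubicDifferential R) (σ : HyperbolicMetric R) (u : X → ℝ) : Prop :=
  ∀ φ ∈ R.charts, ∀ z₀ ∈ φ.target, ∃ U : Set ℂ, IsOpen U ∧ z₀ ∈ U ∧ U ⊆ φ.target ∧
    ∃ (f : ℂ → Fin 3 → ℝ) (Γ : ℂ → ℂ → ℂ → ℂ),
      IsHyperbolicAffineSphere U f
        (fun z X Y => Real.exp (u (φ.symm z)) * σ.density φ z * (conj X * Y).re) Γ ∧
      ∀ z ∈ U, q.coeff φ z =
        ((Real.exp (u (φ.symm z)) * σ.density φ z : ℝ) : ℂ) * pickComponent (Γ z)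

/-- `F = (3/2) (u - (1/3) log (2 |q|² / σ³))`, the difference of the logarithmic densities of the
metrics `e^u σ` and `2^(1/3) |q|^(2/3)` up to the factor `3/2`. -/
def logDensityDifference {X : Type*} [TopologicalSpace X] {R : RiemannSurfaceStructure X}
    (q : HolomorphicCubicDifferential R) (σ : HyperbolicMetric R) (u : X → ℝ) (p : X) : ℝ :=
  3 / 2 * (u p - 1 / 3 * Real.log
    (2 * ‖q.coeff (R.chart p) (R.chart p p)‖ ^ 2 / σ.density (R.chart p) (R.chart p p) ^ 3))

/-- The metrics `|q_n|^(2/3) / ‖q_n‖` on the smooth surface `S` converge, uniformly on compact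
subsets of the open subset `ι.source`, to the pull-back of `|q|^(2/3)` by `ι`, as tensors: in every
smooth chart `ψ` of `S`, uniformly over compact sets of points and over tangent vectors `v` of
length at most one in the coordinates of `ψ`. -/
def FlatMetricsConverge {S X : Type*} [TopologicalSpace S] [ChartedSpace ℂ S] [TopologicalSpace X]
    {R : ℕ → RiemannSurfaceStructure S} (qn : ∀ n, HolomorphicCubicDifferential (R n))
    {RX : RiemannSurfaceStructure X} {P : Set X} (q : CubicDifferential RX P)
    (ι : OpenPartialHomeomorph S X) : Prop :=
  ∀ ψ ∈ IsManifold.maximalAtlas 𝓘(ℝ, ℂ) ∞ S, ∀ K : Set S, IsCompact K →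
    K ⊆ ψ.source ∩ ι.source →
    TendstoUniformlyOn
      (fun n (a : S × ℂ) => (qn n).flatMetric ψ.symm (ψ a.1) a.2 / (qn n).mass)
      (fun a : S × ℂ => q.flatMetric (ι ∘ ψ.symm) (ψ a.1) a.2)
      atTop (K ×ˢ Metric.closedBall (0 : ℂ) 1)

end

/-! ### Wang's equation for the Blaschke metric -/

section Wang

/-! The proof is a maximum principle on a large flat square around `p`. The conformal factor `E` of
the Blaschke metric satisfies Wang's equation `Δ log E = 2E - 4|q|²/E²`. In a flat coordinate `W`
with `W'^3 = q`, write `E = 2^(1/3) |W'|² e^s`, so that `F = (3/2) s`. Since `log |q|` is harmonic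
away from the zeros, the equation becomes `Δ s = 2·2^(1/3) |W'|² (e^s - e^(-2s))`, and where `s > 0`
this is at least `4 |W'|² sinh s`.

On the other side stands an explicit barrier. The function `2 log coth` solves `g'' = 4 sinh g` on
the half line, is infinite at `0` and decays like `e^(-x)`. The sum of four copies, one for the
distance to each side of a square, is a supersolution `G`, because `sinh` is superadditive on
nonnegative numbers. As `G` is infinite on the boundary, `s - G` has an interior maximum, and at a
point where `s > G > 0` the Laplacians contradict each other. Hence `s ≤ G`, and at the centre of a
square of half side `ρ` this is exponentially small in `ρ`.

It remains to find a large square. The complex structures vary with `n`, so all sizes are measured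
in one fixed smooth chart. There, convergence of the metrics as tensors bounds `|q_n|^(2/3)` below
by a multiple of `‖q_n‖` on a fixed disc. The developing map `w` of `q_n` on this disc expands
lengths by a factor of order `√‖q_n‖`. It need not be injective, but lifting straight segments gives
a continuous section over a flat disc whose radius is of that order, and the comparison is carried
out through this section.

The main ingredients are `IsHyperbolicAffineSphere.wang_equation`, `le_squareBarrier_of_isLocalMax`,
`exists_section_of_expanding`, `CubicDifferential.exists_developing_map`,
`IsBlaschke.logDensityDifference_le` and `exists_flatMetric_lower_bound`. -/

lemma two_le_smooth : (2 : WithTop ℕ∞) ≤ ((⊤ : ℕ∞) : WithTop ℕ∞) :=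
  WithTop.coe_le_coe.2 (le_top : (2 : ℕ∞) ≤ ⊤)

/-- On the complex plane the Laplacian is the sum of the iterated directional derivatives along `1`
and `I`. -/
lemma laplacian_eq_fderiv_fderiv {g : ℂ → ℝ} {z : ℂ} (hg : ContDiffAt ℝ 2 g z) :
    Laplacian.laplacian g z = fderiv ℝ (fun w => fderiv ℝ g w 1) z 1 +
      fderiv ℝ (fun w => fderiv ℝ g w Complex.I) z Complex.I := by
  have hd : DifferentiableAt ℝ (fderiv ℝ g) z :=
    (hg.fderiv_right (m := 1) (by norm_num)).differentiableAt (by norm_num)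
  have key : ∀ v : ℂ, fderiv ℝ (fun w => fderiv ℝ g w v) z v = fderiv ℝ (fderiv ℝ g) z v v := by
    intro v
    rw [fderiv_clm_apply hd (differentiableAt_const v)]
    simp
  rw [InnerProductSpace.laplacian_eq_iteratedFDeriv_complexPlane, key, key]
  simp [iteratedFDeriv_two_apply]

/-- The product rule for a `3 × 3` determinant of vector-valued functions. -/
lemma fderiv_det_of_rows {A B C : ℂ → Fin 3 → ℝ} {z : ℂ} (hA : DifferentiableAt ℝ A z)
    (hB : DifferentiableAt ℝ B z) (hC : DifferentiableAt ℝ C z) (v : ℂ) :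
    fderiv ℝ (fun w => (Matrix.of ![A w, B w, C w]).det) z v =
      (Matrix.of ![fderiv ℝ A z v, B z, C z]).det + (Matrix.of ![A z, fderiv ℝ B z v, C z]).det +
        (Matrix.of ![A z, B z, fderiv ℝ C z v]).det := by
  have comp : ∀ {D : ℂ → Fin 3 → ℝ}, DifferentiableAt ℝ D z → ∀ i,
      HasFDerivAt (fun w => D w i) ((ContinuousLinearMap.proj i).comp (fderiv ℝ D z)) z :=
    fun hD i => (hasFDerivAt_pi'.1 hD.hasFDerivAt) i
  have hfun : (fun w => (Matrix.of ![A w, B w, C w]).det) = fun w =>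
      A w 0 * (B w 1 * C w 2) - A w 0 * (B w 2 * C w 1) - A w 1 * (B w 0 * C w 2)
        + A w 1 * (B w 2 * C w 0) + A w 2 * (B w 0 * C w 1) - A w 2 * (B w 1 * C w 0) := by
    funext w
    simp [Matrix.det_fin_three]
    ring
  have m := fun i j k => (comp hA i).fun_mul ((comp hB j).fun_mul (comp hC k))
  rw [hfun, (((((m 0 1 2).fun_sub (m 0 2 1)).fun_sub (m 1 0 2)).fun_add (m 1 2 0)).fun_add
    (m 2 0 1)).fun_sub (m 2 1 0) |>.fderiv]
  simp [Matrix.det_fin_three]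
  ring

/-- Three vectors with non-vanishing determinant are linearly independent. -/
lemma coeff_eq_of_det_ne_zero {P Q R : Fin 3 → ℝ} (h : (Matrix.of ![P, Q, R]).det ≠ 0)
    {a b c a' b' c' : ℝ} (he : a • P + b • Q + c • R = a' • P + b' • Q + c' • R) :
    a = a' ∧ b = b' ∧ c = c' := by
  have hli := Matrix.linearIndependent_rows_of_det_ne_zero h
  rw [Fintype.linearIndependent_iff] at hli
  have := hli ![a - a', b - b', c - c'] (by
    rw [Fin.sum_univ_three]
    change (a - a') • P + (b - b') • Q + (c - c') • R = 0
    linear_combination (norm := module) he)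
  have h0 := this 0
  have h1 := this 1
  have h2 := this 2
  simp at h0 h1 h2
  exact ⟨by linarith, by linarith, by linarith⟩

lemma fderiv_apply_eq_re_im (f : ℂ → Fin 3 → ℝ) (z v : ℂ) :
    fderiv ℝ f z v = v.re • fderiv ℝ f z 1 + v.im • fderiv ℝ f z Complex.I := by
  conv_lhs => rw [← Complex.re_add_im v]
  rw [← map_smul, ← map_smul, ← map_add]
  congr 1
  simp

lemma contDiffOn_det_of_rows {U : Set ℂ} {A B C : ℂ → Fin 3 → ℝ} (hA : ContDiffOn ℝ ∞ A U)
    (hB : ContDiffOn ℝ ∞ B U) (hC : ContDiffOn ℝ ∞ C U) :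
    ContDiffOn ℝ ∞ (fun w => (Matrix.of ![A w, B w, C w]).det) U := by
  have hA' := contDiffOn_pi.1 hA
  have hB' := contDiffOn_pi.1 hB
  have hC' := contDiffOn_pi.1 hC
  simp only [Matrix.det_fin_three, Matrix.of_apply, Matrix.cons_val_zero, Matrix.cons_val_one,
    Matrix.cons_val]
  have m := fun i j k => ((hA' i).mul (hB' j)).mul (hC' k)
  exact (((((m 0 1 2).sub (m 0 2 1)).sub (m 1 0 2)).add (m 1 2 0)).add (m 2 0 1)).sub (m 2 1 0)

lemma fderiv_frame_combination {α β γ : ℂ → ℝ} {P Q R : ℂ → Fin 3 → ℝ} {z : ℂ}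
    (hα : DifferentiableAt ℝ α z) (hβ : DifferentiableAt ℝ β z) (hγ : DifferentiableAt ℝ γ z)
    (hP : DifferentiableAt ℝ P z) (hQ : DifferentiableAt ℝ Q z) (hR : DifferentiableAt ℝ R z)
    (v : ℂ) :
    fderiv ℝ (fun w => α w • P w + β w • Q w + γ w • R w) z v =
      fderiv ℝ α z v • P z + α z • fderiv ℝ P z v + (fderiv ℝ β z v • Q z + β z • fderiv ℝ Q z v) +
        (fderiv ℝ γ z v • R z + γ z • fderiv ℝ R z v) := by
  rw [((hα.hasFDerivAt.fun_smul hP.hasFDerivAt).fun_add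
    (hβ.hasFDerivAt.fun_smul hQ.hasFDerivAt)).fun_add
    (hγ.hasFDerivAt.fun_smul hR.hasFDerivAt) |>.fderiv]
  simp
  abel

lemma fderiv_fderiv_apply_comm {g : ℂ → Fin 3 → ℝ} {z : ℂ} (hg : ContDiffAt ℝ 2 g z) (u v : ℂ) :
    fderiv ℝ (fun w => fderiv ℝ g w u) z v = fderiv ℝ (fun w => fderiv ℝ g w v) z u := by
  have hd : DifferentiableAt ℝ (fderiv ℝ g) z :=
    (hg.fderiv_right (m := 1) (by norm_num)).differentiableAt (by norm_num)
  rw [fderiv_clm_apply hd (differentiableAt_const u), fderiv_clm_apply hd (differentiableAt_const v)]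
  simpa using hg.isSymmSndFDerivAt (by simp) v u

lemma det_frame_combination_fst {P Q R : Fin 3 → ℝ} (α β γ : ℝ) :
    (Matrix.of ![α • P + β • Q + γ • R, Q, R]).det = α * (Matrix.of ![P, Q, R]).det := by
  simp [Matrix.det_fin_three]
  ring

lemma det_frame_combination_snd {P Q R : Fin 3 → ℝ} (α β γ : ℝ) :
    (Matrix.of ![P, α • P + β • Q + γ • R, R]).det = β * (Matrix.of ![P, Q, R]).det := by
  simp [Matrix.det_fin_three]
  ring

/-- The hypothesis is apolarity of the Blaschke connection in conformal coordinates. It leaves only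
two real combinations of Christoffel symbols, the ones whose squares come out of the integrability
conditions. -/
lemma norm_sq_pickComponent {Γ : ℂ → ℂ → ℂ} (h : Γ Complex.I Complex.I = -Γ 1 1) :
    4 * ‖pickComponent Γ‖ ^ 2 = ((Γ 1 1).re - (Γ 1 Complex.I).im) ^ 2 +
      ((Γ 1 1).im + (Γ 1 Complex.I).re) ^ 2 := by
  have : pickComponent Γ = (⟨((Γ 1 1).re - (Γ 1 Complex.I).im) / 2,
      -((Γ 1 1).im + (Γ 1 Complex.I).re) / 2⟩ : ℂ) := by
    rw [pickComponent, h, div_eq_iff (by norm_num)]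
    apply Complex.ext <;> simp <;> ring
  rw [this, Complex.sq_norm, Complex.normSq_mk]
  ring

/-- The conformal factor `E` of the Blaschke metric of a hyperbolic affine sphere is smooth, and
satisfies Wang's equation. -/
theorem IsHyperbolicAffineSphere.wang_equation {U : Set ℂ} (hU : IsOpen U) {f : ℂ → Fin 3 → ℝ}
    {Γ : ℂ → ℂ → ℂ → ℂ} {E : ℂ → ℝ}
    (h : IsHyperbolicAffineSphere U f (fun z X Y => E z * (conj X * Y).re) Γ) {z : ℂ}
    (hz : z ∈ U) :
    ContDiffAt ℝ ∞ E z ∧ Laplacian.laplacian (fun w => Real.log (E w)) z =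
      2 * E z - 4 * ‖pickComponent (Γ z)‖ ^ 2 := by
  have hE : ∀ w ∈ U, 0 < E w := fun w hw => by simpa using h.pos w hw 1 one_ne_zero
  set fx : ℂ → Fin 3 → ℝ := fun w => fderiv ℝ f w 1 with hfx
  set fy : ℂ → Fin 3 → ℝ := fun w => fderiv ℝ f w Complex.I with hfy
  set N : ℂ → ℝ := fun w => (Matrix.of ![fx w, fy w, f w]).det with hN
  have hNE : ∀ w ∈ U, N w ^ 2 = E w ^ 2 := fun w hw => by
    have := h.volume w hw 1 Complex.I
    simp at this
    rw [hN]
    simp only [hfx, hfy]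
    rw [this]
    ring
  have hN0 : ∀ w ∈ U, N w ≠ 0 := fun w hw h0 => by
    have := hNE w hw
    rw [h0] at this
    have := hE w hw
    nlinarith
  have cf : ContDiffOn ℝ ∞ f U := h.smooth
  have cd : ∀ {g : ℂ → Fin 3 → ℝ}, ContDiffOn ℝ ∞ g U → ∀ v : ℂ,
      ContDiffOn ℝ ∞ (fun w => fderiv ℝ g w v) U := fun hg v =>
    (hg.fderiv_of_isOpen hU (by simp)).clm_apply contDiffOn_const
  have cfx : ContDiffOn ℝ ∞ fx U := cd cf 1
  have cfy : ContDiffOn ℝ ∞ fy U := cd cf Complex.I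
  have cN : ContDiffOn ℝ ∞ N U := contDiffOn_det_of_rows cfx cfy cf
  -- No regularity of the conformal factor is assumed; it is inherited from the volume `N`, whose
  -- square is `E ^ 2`.
  have cE : ContDiffOn ℝ ∞ E U := by
    have : ContDiffOn ℝ ∞ (fun w => √(N w ^ 2)) U :=
      (cN.pow 2).sqrt fun w hw => pow_ne_zero 2 (hN0 w hw)
    refine this.congr fun w hw => ?_
    rw [hNE w hw, Real.sqrt_sq (hE w hw).le]
  have dAt : ∀ {F : Type} [NormedAddCommGroup F] [NormedSpace ℝ F] {g : ℂ → F},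
      ContDiffOn ℝ ∞ g U → ∀ w ∈ U, DifferentiableAt ℝ g w := fun hg w hw =>
    (hg.contDiffAt (hU.mem_nhds hw)).differentiableAt (by simp)
  set a : ℂ → ℝ := fun w => (Γ w 1 1).re with ha
  set b : ℂ → ℝ := fun w => (Γ w 1 1).im with hb
  set c : ℂ → ℝ := fun w => (Γ w 1 Complex.I).re with hc
  set d : ℂ → ℝ := fun w => (Γ w 1 Complex.I).im with hd
  set g : ℂ → ℝ := fun w => (Γ w Complex.I Complex.I).re with hg
  set k : ℂ → ℝ := fun w => (Γ w Complex.I Complex.I).im with hk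
  have S11 : ∀ w ∈ U, fderiv ℝ fx w 1 = a w • fx w + b w • fy w + E w • f w := fun w hw => by
    rw [h.structure_eq w hw 1 1, fderiv_apply_eq_re_im]
    simp [ha, hb, hfx, hfy]
  have S12 : ∀ w ∈ U, fderiv ℝ fy w 1 = c w • fx w + d w • fy w + (0 : ℝ) • f w := fun w hw => by
    rw [h.structure_eq w hw 1 Complex.I, fderiv_apply_eq_re_im]
    simp [hc, hd, hfx, hfy]
  have S21 : ∀ w ∈ U, fderiv ℝ fx w Complex.I = c w • fx w + d w • fy w + (0 : ℝ) • f w :=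
    fun w hw => by
    rw [← S12 w hw]
    exact fderiv_fderiv_apply_comm ((cf.contDiffAt (hU.mem_nhds hw)).of_le two_le_smooth) _ _
  have S22 : ∀ w ∈ U, fderiv ℝ fy w Complex.I = g w • fx w + k w • fy w + E w • f w :=
    fun w hw => by
    rw [h.structure_eq w hw Complex.I Complex.I, fderiv_apply_eq_re_im]
    simp [hg, hk, hfx, hfy]
  -- The Christoffel symbols are not assumed smooth either. By Cramer's rule they are quotients of
  -- smooth determinants by `N`.
  have smooth_fst : ∀ {V : ℂ → Fin 3 → ℝ} {α β γ : ℂ → ℝ}, ContDiffOn ℝ ∞ V U →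
      (∀ w ∈ U, V w = α w • fx w + β w • fy w + γ w • f w) → ContDiffOn ℝ ∞ α U := by
    intro V α β γ hV he
    refine ((contDiffOn_det_of_rows hV cfy cf).div cN hN0).congr fun w hw => ?_
    change α w = (Matrix.of ![V w, fy w, f w]).det / N w
    rw [he w hw, det_frame_combination_fst, mul_div_cancel_right₀ _ (hN0 w hw)]
  have smooth_snd : ∀ {V : ℂ → Fin 3 → ℝ} {α β γ : ℂ → ℝ}, ContDiffOn ℝ ∞ V U →
      (∀ w ∈ U, V w = α w • fx w + β w • fy w + γ w • f w) → ContDiffOn ℝ ∞ β U := by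
    intro V α β γ hV he
    refine ((contDiffOn_det_of_rows cfx hV cf).div cN hN0).congr fun w hw => ?_
    change β w = (Matrix.of ![fx w, V w, f w]).det / N w
    rw [he w hw, det_frame_combination_snd, mul_div_cancel_right₀ _ (hN0 w hw)]
  have sa := smooth_fst (cd cfx 1) S11
  have sb := smooth_snd (cd cfx 1) S11
  have sc := smooth_fst (γ := fun _ => 0) (cd cfy 1) S12
  have sd := smooth_snd (γ := fun _ => 0) (cd cfy 1) S12
  have sg := smooth_fst (cd cfy Complex.I) S22
  have sk := smooth_snd (cd cfy Complex.I) S22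
  -- the derivatives of the volume
  have apolar : ∀ w ∈ U, fderiv ℝ E w 1 = E w * (a w + d w) ∧
      fderiv ℝ E w Complex.I = E w * (c w + k w) := by
    intro w hw
    -- Differentiating `N ^ 2 = E ^ 2` avoids deciding the sign of `N`.
    have hv : ∀ v : ℂ, N w * fderiv ℝ N w v = E w * fderiv ℝ E w v := by
      intro v
      have heq : (fun y => N y ^ 2) =ᶠ[𝓝 w] fun y => E y ^ 2 :=
        eventually_of_mem (hU.mem_nhds hw) hNE
      have h1 := congrArg (fun T : ℂ →L[ℝ] ℝ => T v) heq.fderiv_eq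
      rw [((dAt cN w hw).hasFDerivAt.pow 2).fderiv, ((dAt cE w hw).hasFDerivAt.pow 2).fderiv] at h1
      simp at h1
      linarith
    have h2 := hNE w hw
    have hEw := (hE w hw).ne'
    constructor
    · have h1 := hv 1
      have h3 : fderiv ℝ N w 1 = (a w + d w) * N w := by
        rw [hN, fderiv_det_of_rows (dAt cfx w hw) (dAt cfy w hw) (dAt cf w hw), S11 w hw, S12 w hw,
          det_frame_combination_fst, det_frame_combination_snd]
        have : (Matrix.of ![fx w, fy w, fderiv ℝ f w 1]).det = 0 :=
          Matrix.det_zero_of_row_eq (i := 0) (j := 2) (by decide) rfl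
        rw [this]
        ring
      rw [h3] at h1
      apply mul_left_cancel₀ hEw
      linear_combination -h1 + (a w + d w) * h2
    · have h1 := hv Complex.I
      have h3 : fderiv ℝ N w Complex.I = (c w + k w) * N w := by
        rw [hN, fderiv_det_of_rows (dAt cfx w hw) (dAt cfy w hw) (dAt cf w hw), S21 w hw, S22 w hw,
          det_frame_combination_fst, det_frame_combination_snd]
        have : (Matrix.of ![fx w, fy w, fderiv ℝ f w Complex.I]).det = 0 :=
          Matrix.det_zero_of_row_eq (i := 1) (j := 2) (by decide) rfl
        rw [this]
        ring
      rw [h3] at h1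
      apply mul_left_cancel₀ hEw
      linear_combination -h1 + (c w + k w) * h2
  -- the integrability conditions
  have z0 : ∀ (w v : ℂ), fderiv ℝ (fun _ : ℂ => (0 : ℝ)) w v = 0 := by simp
  have int1 : ∀ w ∈ U, fderiv ℝ b w Complex.I + a w * d w + b w * k w + E w =
      fderiv ℝ d w 1 + c w * b w + d w * d w ∧
      b w * E w + fderiv ℝ E w Complex.I = c w * E w := by
    intro w hw
    have hn := hU.mem_nhds hw
    have h1 := fderiv_fderiv_apply_comm ((cfx.contDiffAt hn).of_le (m := 2) two_le_smooth) 1 Complex.I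
    rw [Filter.EventuallyEq.fderiv_eq (eventually_of_mem hn S11),
      Filter.EventuallyEq.fderiv_eq (eventually_of_mem hn S21),
      fderiv_frame_combination (dAt sa w hw) (dAt sb w hw) (dAt cE w hw) (dAt cfx w hw)
        (dAt cfy w hw) (dAt cf w hw),
      fderiv_frame_combination (dAt sc w hw) (dAt sd w hw) (differentiableAt_const 0)
        (dAt cfx w hw) (dAt cfy w hw) (dAt cf w hw), S11 w hw, S12 w hw, S21 w hw, S22 w hw,
        z0] at h1
    change _ + (_ + E w • fy w) = _ at h1
    have h2 : (fderiv ℝ a w Complex.I + a w * c w + b w * g w) • fx w +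
        (fderiv ℝ b w Complex.I + a w * d w + b w * k w + E w) • fy w +
        (b w * E w + fderiv ℝ E w Complex.I) • f w =
        (fderiv ℝ c w 1 + c w * a w + d w * c w) • fx w +
        (fderiv ℝ d w 1 + c w * b w + d w * d w) • fy w + (c w * E w) • f w := by
      linear_combination (norm := module) h1
    exact (coeff_eq_of_det_ne_zero (hN0 w hw) h2).2
  have int2 : ∀ w ∈ U, fderiv ℝ g w 1 + g w * a w + k w * c w + E w =
      fderiv ℝ c w Complex.I + c w * c w + d w * g w ∧
      g w * E w + fderiv ℝ E w 1 = d w * E w := by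
    intro w hw
    have hn := hU.mem_nhds hw
    have h1 := fderiv_fderiv_apply_comm ((cfy.contDiffAt hn).of_le (m := 2) two_le_smooth) Complex.I 1
    rw [Filter.EventuallyEq.fderiv_eq (eventually_of_mem hn S22),
      Filter.EventuallyEq.fderiv_eq (eventually_of_mem hn S12),
      fderiv_frame_combination (dAt sg w hw) (dAt sk w hw) (dAt cE w hw) (dAt cfx w hw)
        (dAt cfy w hw) (dAt cf w hw),
      fderiv_frame_combination (dAt sc w hw) (dAt sd w hw) (differentiableAt_const 0)
        (dAt cfx w hw) (dAt cfy w hw) (dAt cf w hw), S11 w hw, S12 w hw, S21 w hw, S22 w hw,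
        z0] at h1
    change _ + (_ + E w • fx w) = _ at h1
    have h2 : (fderiv ℝ g w 1 + g w * a w + k w * c w + E w) • fx w +
        (fderiv ℝ k w 1 + g w * b w + k w * d w) • fy w +
        (g w * E w + fderiv ℝ E w 1) • f w =
        (fderiv ℝ c w Complex.I + c w * c w + d w * g w) • fx w +
        (fderiv ℝ d w Complex.I + c w * d w + d w * k w) • fy w + (d w * E w) • f w := by
      linear_combination (norm := module) h1
    have := coeff_eq_of_det_ne_zero (hN0 w hw) h2
    exact ⟨this.1, this.2.2⟩
  -- The `f`-components of the integrability conditions, compared with the derivatives of the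
  -- volume, give apolarity: `Γ(I, I) = -Γ(1, 1)`.
  have hga : ∀ w ∈ U, g w = -a w := fun w hw => by
    apply mul_left_cancel₀ (hE w hw).ne'
    linear_combination (int2 w hw).2 - (apolar w hw).1
  have hkb : ∀ w ∈ U, k w = -b w := fun w hw => by
    apply mul_left_cancel₀ (hE w hw).ne'
    linear_combination (int1 w hw).2 - (apolar w hw).2
  have clog : ContDiffAt ℝ ∞ (fun w => Real.log (E w)) z :=
    (cE.contDiffAt (hU.mem_nhds hz)).log (hE z hz).ne'
  have hlog : ∀ w ∈ U, ∀ v, fderiv ℝ (fun w => Real.log (E w)) w v = (E w)⁻¹ * fderiv ℝ E w v := by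
    intro w hw v
    rw [((dAt cE w hw).hasFDerivAt.log (hE w hw).ne').fderiv]
    simp
  have hlx : (fun w => fderiv ℝ (fun w => Real.log (E w)) w 1) =ᶠ[𝓝 z] fun w => a w + d w :=
    eventually_of_mem (hU.mem_nhds hz) fun w hw => by
      change fderiv ℝ (fun w => Real.log (E w)) w 1 = _
      rw [hlog w hw, (apolar w hw).1, inv_mul_cancel_left₀ (hE w hw).ne']
  have hly : (fun w => fderiv ℝ (fun w => Real.log (E w)) w Complex.I) =ᶠ[𝓝 z]
      fun w => c w - b w :=
    eventually_of_mem (hU.mem_nhds hz) fun w hw => by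
      change fderiv ℝ (fun w => Real.log (E w)) w Complex.I = _
      rw [hlog w hw, (apolar w hw).2, inv_mul_cancel_left₀ (hE w hw).ne', hkb w hw]
      ring
  refine ⟨cE.contDiffAt (hU.mem_nhds hz), ?_⟩
  have hgx : fderiv ℝ g z 1 = -fderiv ℝ a z 1 := by
    rw [Filter.EventuallyEq.fderiv_eq (eventually_of_mem (hU.mem_nhds hz) hga), fderiv_fun_neg]
    rfl
  rw [laplacian_eq_fderiv_fderiv (clog.of_le two_le_smooth), hlx.fderiv_eq, hly.fderiv_eq,
    fderiv_fun_add (dAt sa z hz) (dAt sd z hz), fderiv_fun_sub (dAt sc z hz) (dAt sb z hz),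
    norm_sq_pickComponent (Complex.ext (by simpa using hga z hz) (by simpa using hkb z hz))]
  -- The remaining components are the curvature equations; their sum is the Laplacian of `log E`.
  have i1 := (int1 z hz).1
  have i2 := (int2 z hz).1
  rw [hkb z hz] at i1 i2
  rw [hga z hz, hgx] at i2
  simp only [add_apply, sub_apply]
  change _ = 2 * E z - ((a z - d z) ^ 2 + (b z + c z) ^ 2)
  linear_combination -i1 - i2

end Wang

/-! ### A comparison function on squares -/

section Comparison

/-- The second derivative test in one variable: a necessary condition. -/
lemma deriv_deriv_nonpos_of_isLocalMax {h : ℝ → ℝ} {t : ℝ} (hc : ContinuousAt h t)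
    (hmax : IsLocalMax h t) : deriv (deriv h) t ≤ 0 := by
  by_contra! hpos
  -- A local maximum that is also a local minimum makes `h` locally constant, so its second
  -- derivative vanishes.
  have hmin := isLocalMin_of_deriv_deriv_pos hpos hmax.deriv_eq_zero hc
  have heq : h =ᶠ[𝓝 t] fun _ => h t := by
    filter_upwards [hmax, hmin] with s h1 h2 using le_antisymm h1 h2
  have h2 : deriv h =ᶠ[𝓝 t] fun _ => 0 := by
    filter_upwards [heq.eventuallyEq_nhds] with s hs
    rw [hs.deriv_eq, deriv_const]
  rw [h2.deriv_eq, deriv_const] at hpos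
  exact lt_irrefl _ hpos

lemma fderiv_fderiv_nonpos_of_isLocalMax {g : ℂ → ℝ} {z : ℂ} (hg : ContDiffAt ℝ 2 g z)
    (hmax : IsLocalMax g z) (v : ℂ) : fderiv ℝ (fun w => fderiv ℝ g w v) z v ≤ 0 := by
  have hline : ∀ t : ℝ, HasDerivAt (fun t : ℝ => z + t • v) v t := fun t => by
    simpa using ((hasDerivAt_id t).smul_const v).const_add z
  have h0 : z + (0 : ℝ) • v = z := by simp
  have hcont : Tendsto (fun t : ℝ => z + t • v) (𝓝 0) (𝓝 z) := by
    have := (hline 0).continuousAt.tendsto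
    rwa [h0] at this
  have hd : ∀ᶠ w in 𝓝 z, DifferentiableAt ℝ g w :=
    (hg.eventually (by simp)).mono fun w hw => hw.differentiableAt (by simp)
  have hderiv : deriv (fun t : ℝ => g (z + t • v)) =ᶠ[𝓝 0] fun t => fderiv ℝ g (z + t • v) v := by
    filter_upwards [hcont.eventually hd] with t ht
    exact (ht.hasFDerivAt.comp_hasDerivAt t (hline t)).deriv
  have hD : DifferentiableAt ℝ (fun w => fderiv ℝ g w v) (z + (0 : ℝ) • v) := by
    rw [h0]
    exact ((hg.fderiv_right (m := 1) (by norm_num)).differentiableAt (by norm_num)).clm_apply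
      (differentiableAt_const v)
  have h2 := (hD.hasFDerivAt.comp_hasDerivAt (0 : ℝ) (hline 0)).deriv
  have h3 := hderiv.deriv_eq
  change deriv (fun t : ℝ => fderiv ℝ g (z + t • v) v) 0 = _ at h2
  rw [h2, h0] at h3
  rw [← h3]
  refine deriv_deriv_nonpos_of_isLocalMax ?_ ?_
  · refine ContinuousAt.comp (g := g) ?_ (hline 0).continuousAt
    rw [h0]
    exact hg.continuousAt
  · have := hcont.eventually hmax
    filter_upwards [this] with t ht
    simpa using ht

lemma laplacian_nonpos_of_isLocalMax {g : ℂ → ℝ} {z : ℂ} (hg : ContDiffAt ℝ 2 g z)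
    (hmax : IsLocalMax g z) : Laplacian.laplacian g z ≤ 0 := by
  rw [laplacian_eq_fderiv_fderiv hg]
  exact add_nonpos (fderiv_fderiv_nonpos_of_isLocalMax hg hmax _)
    (fderiv_fderiv_nonpos_of_isLocalMax hg hmax _)

lemma laplacian_fun_add {f g : ℂ → ℝ} {z : ℂ} (hf : ContDiffAt ℝ 2 f z) (hg : ContDiffAt ℝ 2 g z) :
    Laplacian.laplacian (fun w => f w + g w) z =
      Laplacian.laplacian f z + Laplacian.laplacian g z :=
  hf.laplacian_add hg

lemma laplacian_fun_sub {f g : ℂ → ℝ} {z : ℂ} (hf : ContDiffAt ℝ 2 f z) (hg : ContDiffAt ℝ 2 g z) :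
    Laplacian.laplacian (fun w => f w - g w) z =
      Laplacian.laplacian f z - Laplacian.laplacian g z :=
  hf.laplacian_sub hg

lemma laplacian_fun_const_mul {g : ℂ → ℝ} {z : ℂ} (a : ℝ) (hg : ContDiffAt ℝ 2 g z) :
    Laplacian.laplacian (fun w => a * g w) z = a * Laplacian.laplacian g z :=
  InnerProductSpace.laplacian_smul a hg

lemma AnalyticAt.contDiffAt_re {Y : ℂ → ℂ} {z : ℂ} (hY : AnalyticAt ℂ Y z) :
    ContDiffAt ℝ 2 (fun w => (Y w).re) z :=
  Complex.reCLM.contDiff.contDiffAt.comp z (hY.contDiffAt.restrict_scalars ℝ)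

/-- The Laplacian of a function of the real part of a holomorphic function. -/
lemma laplacian_comp_re {Y : ℂ → ℂ} {z : ℂ} (hY : AnalyticAt ℂ Y z) {g : ℝ → ℝ}
    (hg : ContDiffAt ℝ 2 g (Y z).re) :
    Laplacian.laplacian (fun w => g (Y w).re) z = deriv (deriv g) (Y z).re * ‖deriv Y z‖ ^ 2 := by
  have hfd : ∀ {X : ℂ → ℂ} {w : ℂ}, AnalyticAt ℂ X w → HasFDerivAt (fun w => (X w).re)
      (Complex.reCLM.comp ((ContinuousLinearMap.toSpanSingleton ℂ (deriv X w)).restrictScalars ℝ)) w :=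
    fun hX => Complex.reCLM.hasFDerivAt.comp _
      (hX.differentiableAt.hasDerivAt.hasFDerivAt.restrictScalars ℝ)
  have hfirst : ∀ v : ℂ, (fun w => fderiv ℝ (fun w => g (Y w).re) w v) =ᶠ[𝓝 z]
      fun w => deriv g (Y w).re * (v * deriv Y w).re := by
    intro v
    have hge : ∀ᶠ w in 𝓝 z, DifferentiableAt ℝ g (Y w).re :=
      (hfd hY).continuousAt.eventually
        ((hg.eventually (by simp)).mono fun t ht => ht.differentiableAt (by simp))
    filter_upwards [hge, hY.eventually_analyticAt] with w h1 h2
    have h3 := h1.hasDerivAt.comp_hasFDerivAt w (hfd h2)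
    change HasFDerivAt (fun w => g (Y w).re) _ w at h3
    rw [h3.fderiv]
    simp
  have hg' : DifferentiableAt ℝ (deriv g) (Y z).re := by
    have : deriv g = fun t => fderiv ℝ g t 1 := by
      funext t
      simp
    rw [this]
    exact ((hg.fderiv_right (m := 1) (by norm_num)).differentiableAt (by norm_num)).clm_apply
      (differentiableAt_const _)
  have hsecond : ∀ v : ℂ, fderiv ℝ (fun w => fderiv ℝ (fun w => g (Y w).re) w v) z v =
      deriv (deriv g) (Y z).re * (v * deriv Y z).re ^ 2 +
        deriv g (Y z).re * (v * (v * deriv (deriv Y) z)).re := by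
    intro v
    rw [(hfirst v).fderiv_eq]
    have h1 := hg'.hasDerivAt.comp_hasFDerivAt z (hfd hY)
    have h2 := hfd (X := fun w => v * deriv Y w) (analyticAt_const.mul hY.deriv)
    have h3 := h1.mul h2
    change HasFDerivAt (fun w => deriv g (Y w).re * (v * deriv Y w).re) _ z at h3
    rw [h3.fderiv, deriv_const_mul _ hY.deriv.differentiableAt]
    simp
    ring
  have hcomp : ContDiffAt ℝ 2 (fun w => g (Y w).re) z := hg.comp z hY.contDiffAt_re
  -- The `deriv g` terms carry `v * v`, which is `1` for `v = 1` and `-1` for `v = I`, so they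
  -- cancel.
  rw [laplacian_eq_fderiv_fderiv hcomp, hsecond, hsecond, Complex.sq_norm, Complex.normSq_apply]
  simp
  ring

/-- `2 log (coth x)`, a decaying solution of `g'' = 4 sinh g` on the half line which is infinite at
the origin. -/
noncomputable def cothBarrier (x : ℝ) : ℝ := 2 * (Real.log (Real.cosh x) - Real.log (Real.sinh x))

lemma contDiffAt_cothBarrier {x : ℝ} (hx : 0 < x) : ContDiffAt ℝ 2 cothBarrier x := by
  unfold cothBarrier
  have h1 : ContDiffAt ℝ 2 (fun x => Real.log (Real.cosh x)) x :=
    Real.contDiff_cosh.contDiffAt.log (Real.cosh_pos x).ne'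
  have h2 : ContDiffAt ℝ 2 (fun x => Real.log (Real.sinh x)) x :=
    Real.contDiff_sinh.contDiffAt.log (Real.sinh_pos_iff.2 hx).ne'
  exact contDiffAt_const.mul (h1.sub h2)

lemma hasDerivAt_cothBarrier {x : ℝ} (hx : 0 < x) :
    HasDerivAt cothBarrier (-2 / (Real.sinh x * Real.cosh x)) x := by
  have hs := Real.sinh_pos_iff.2 hx
  have hc := Real.cosh_pos x
  have := (((Real.hasDerivAt_cosh x).log hc.ne').sub
    ((Real.hasDerivAt_sinh x).log hs.ne')).const_mul 2
  refine HasDerivAt.congr_deriv this ?_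
  field_simp
  linear_combination -Real.cosh_sq x

lemma exp_cothBarrier {x : ℝ} (hx : 0 < x) :
    Real.exp (cothBarrier x) = (Real.cosh x / Real.sinh x) ^ 2 := by
  have hs := Real.sinh_pos_iff.2 hx
  have hc := Real.cosh_pos x
  rw [cothBarrier, ← Real.log_div hc.ne' hs.ne', mul_comm, Real.exp_mul,
    Real.exp_log (div_pos hc hs)]
  exact Real.rpow_ofNat _ 2

/-- Since `e^g = coth²`, the right side is `2 (coth² - tanh²)`, which is the derivative of `-2 /
(sinh cosh)`. -/
lemma deriv_deriv_cothBarrier {x : ℝ} (hx : 0 < x) :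
    deriv (deriv cothBarrier) x = 4 * Real.sinh (cothBarrier x) := by
  have hs := Real.sinh_pos_iff.2 hx
  have hc := Real.cosh_pos x
  have h1 : deriv cothBarrier =ᶠ[𝓝 x] fun y => -2 / (Real.sinh y * Real.cosh y) := by
    filter_upwards [lt_mem_nhds hx] with y hy using (hasDerivAt_cothBarrier hy).deriv
  have h2 := (hasDerivAt_const x (-2 : ℝ)).div
    ((Real.hasDerivAt_sinh x).mul (Real.hasDerivAt_cosh x)) (mul_pos hs hc).ne'
  rw [h1.deriv_eq]
  refine h2.deriv.trans ?_
  rw [Real.sinh_eq (cothBarrier x), Real.exp_neg, exp_cothBarrier hx]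
  have hcs := Real.cosh_sq x
  simp only [Pi.mul_apply]
  field_simp
  have h4 : Real.cosh x ^ 4 = (Real.sinh x ^ 2 + 1) ^ 2 := by rw [← hcs]; ring
  rw [h4, hcs]
  ring

lemma cothBarrier_pos {x : ℝ} (hx : 0 < x) : 0 < cothBarrier x := by
  have := Real.log_lt_log (Real.sinh_pos_iff.2 hx) (Real.sinh_lt_cosh x)
  unfold cothBarrier
  linarith

/-- Apply `log t ≤ t - 1` to `t = coth x`. Then `coth x - 1 = e^(-x) / sinh x`, and `sinh x ≥ 1`
once `x ≥ 1`. -/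
lemma cothBarrier_le {x : ℝ} (hx : 1 ≤ x) : cothBarrier x ≤ 2 * Real.exp (-x) := by
  have hs1 : 1 ≤ Real.sinh x := hx.trans (Real.self_le_sinh_iff.2 (by linarith))
  have hs : 0 < Real.sinh x := by linarith
  have hc := Real.cosh_pos x
  have h1 := Real.log_le_sub_one_of_pos (div_pos hc hs)
  have h2 : Real.cosh x / Real.sinh x - 1 ≤ Real.exp (-x) := by
    rw [← Real.cosh_sub_sinh, div_sub_one hs.ne', div_le_iff₀ hs]
    have := Real.sinh_lt_cosh x
    nlinarith
  rw [Real.log_div hc.ne' hs.ne'] at h1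
  unfold cothBarrier
  linarith

lemma tendsto_cothBarrier : Tendsto cothBarrier (𝓝[>] 0) atTop := by
  have h1 : Tendsto (fun x => Real.log (Real.cosh x)) (𝓝[>] 0) (𝓝 (Real.log (Real.cosh 0))) :=
    ((Real.continuous_cosh.log fun x => (Real.cosh_pos x).ne').tendsto 0).mono_left
      nhdsWithin_le_nhds
  have h2 : Tendsto Real.sinh (𝓝[>] 0) (𝓝[>] 0) := by
    refine tendsto_nhdsWithin_iff.2 ⟨?_, ?_⟩
    · simpa using (Real.continuous_sinh.tendsto 0).mono_left nhdsWithin_le_nhds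
    · filter_upwards [self_mem_nhdsWithin] with x hx using Real.sinh_pos_iff.2 hx
  have h3 := tendsto_neg_atBot_atTop.comp (Real.tendsto_log_nhdsGT_zero.comp h2)
  exact (h1.add_atTop h3).const_mul_atTop (by norm_num : (0 : ℝ) < 2)

/-- A comparison function on the square `|Re ζ| < ρ`, `|Im ζ| < ρ`, infinite on its boundary. -/
noncomputable def squareBarrier (ρ : ℝ) (ζ : ℂ) : ℝ :=
  cothBarrier (ρ + ζ.re) + cothBarrier (ρ - ζ.re) + (cothBarrier (ρ + ζ.im) + cothBarrier (ρ - ζ.im))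

lemma laplacian_cothBarrier_comp {Y : ℂ → ℂ} {z : ℂ} (hY : AnalyticAt ℂ Y z) {ρ : ℝ}
    (hρ : 0 < ρ + (Y z).re) :
    ContDiffAt ℝ 2 (fun w => cothBarrier (ρ + (Y w).re)) z ∧
    Laplacian.laplacian (fun w => cothBarrier (ρ + (Y w).re)) z =
      4 * Real.sinh (cothBarrier (ρ + (Y z).re)) * ‖deriv Y z‖ ^ 2 := by
  have hg : ContDiffAt ℝ 2 (fun t => cothBarrier (ρ + t)) (Y z).re :=
    ContDiffAt.comp (g := cothBarrier) _ (contDiffAt_cothBarrier hρ)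
      (contDiffAt_const.add contDiffAt_id)
  refine ⟨ContDiffAt.comp (g := fun t => cothBarrier (ρ + t)) z hg hY.contDiffAt_re, ?_⟩
  rw [laplacian_comp_re hY hg]
  have h1 : deriv (fun t => cothBarrier (ρ + t)) = fun t => deriv cothBarrier (ρ + t) := by
    funext t
    exact deriv_comp_const_add _ _ _
  rw [h1, deriv_comp_const_add, deriv_deriv_cothBarrier hρ]

/-- Immediate from the addition formula and `cosh ≥ 1`. This is what makes a sum of nonnegative
solutions of `Δ g = 4 |W'|² sinh g` a supersolution. -/
lemma sinh_add_sinh_le {x y : ℝ} (hx : 0 ≤ x) (hy : 0 ≤ y) :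
    Real.sinh x + Real.sinh y ≤ Real.sinh (x + y) := by
  rw [Real.sinh_add]
  have h1 := Real.one_le_cosh x
  have h2 := Real.one_le_cosh y
  have h3 := Real.sinh_nonneg_iff.2 hx
  have h4 := Real.sinh_nonneg_iff.2 hy
  nlinarith

lemma squareBarrier_pos {ρ : ℝ} {ζ : ℂ} (hre : |ζ.re| < ρ) (him : |ζ.im| < ρ) :
    0 < squareBarrier ρ ζ := by
  rw [abs_lt] at hre him
  have h1 := cothBarrier_pos (x := ρ + ζ.re) (by linarith)
  have h2 := cothBarrier_pos (x := ρ - ζ.re) (by linarith)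
  have h3 := cothBarrier_pos (x := ρ + ζ.im) (by linarith)
  have h4 := cothBarrier_pos (x := ρ - ζ.im) (by linarith)
  unfold squareBarrier
  linarith

/-- Composed with a holomorphic map, the comparison function is a supersolution. -/
lemma laplacian_squareBarrier_comp_le {W : ℂ → ℂ} {z : ℂ} (hW : AnalyticAt ℂ W z) {ρ : ℝ}
    (hre : |(W z).re| < ρ) (him : |(W z).im| < ρ) :
    ContDiffAt ℝ 2 (fun w => squareBarrier ρ (W w)) z ∧
    Laplacian.laplacian (fun w => squareBarrier ρ (W w)) z ≤
      4 * Real.sinh (squareBarrier ρ (W z)) * ‖deriv W z‖ ^ 2 := by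
  rw [abs_lt] at hre him
  -- Multiplying `W` by a fourth root of unity turns each side of the square into the left one and
  -- does not change `‖deriv W z‖`.
  have key : ∀ α : ℂ, ‖α‖ = 1 → 0 < ρ + (α * W z).re →
      ContDiffAt ℝ 2 (fun w => cothBarrier (ρ + (α * W w).re)) z ∧
      Laplacian.laplacian (fun w => cothBarrier (ρ + (α * W w).re)) z =
        4 * Real.sinh (cothBarrier (ρ + (α * W z).re)) * ‖deriv W z‖ ^ 2 := by
    intro α hα hpos
    have := laplacian_cothBarrier_comp (Y := fun w => α * W w) (analyticAt_const.mul hW) hpos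
    rwa [deriv_const_mul _ hW.differentiableAt, norm_mul, hα, one_mul] at this
  obtain ⟨c1, l1⟩ := key 1 (by simp) (by simp; linarith)
  obtain ⟨c2, l2⟩ := key (-1) (by simp) (by simp; linarith)
  obtain ⟨c3, l3⟩ := key (-Complex.I) (by simp) (by simp; linarith)
  obtain ⟨c4, l4⟩ := key Complex.I (by simp) (by simp; linarith)
  simp only [one_mul, neg_mul, Complex.neg_re, Complex.I_mul_re, neg_neg, ← sub_eq_add_neg]
    at c1 c2 c3 c4 l1 l2 l3 l4
  refine ⟨(c1.add c2).add (c3.add c4), ?_⟩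
  have hsum : Laplacian.laplacian (fun w => squareBarrier ρ (W w)) z =
      4 * (Real.sinh (cothBarrier (ρ + (W z).re)) + Real.sinh (cothBarrier (ρ - (W z).re)) +
        (Real.sinh (cothBarrier (ρ + (W z).im)) + Real.sinh (cothBarrier (ρ - (W z).im)))) *
        ‖deriv W z‖ ^ 2 := by
    refine (laplacian_fun_add (c1.add c2) (c3.add c4)).trans ?_
    rw [laplacian_fun_add c1 c2, laplacian_fun_add c3 c4, l1, l2, l3, l4]
    ring
  rw [hsum]
  have h1 := (cothBarrier_pos (x := ρ + (W z).re) (by linarith)).le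
  have h2 := (cothBarrier_pos (x := ρ - (W z).re) (by linarith)).le
  have h3 := (cothBarrier_pos (x := ρ + (W z).im) (by linarith)).le
  have h4 := (cothBarrier_pos (x := ρ - (W z).im) (by linarith)).le
  have := (add_le_add (sinh_add_sinh_le h1 h2) (sinh_add_sinh_le h3 h4)).trans
    (sinh_add_sinh_le (add_nonneg h1 h2) (add_nonneg h3 h4))
  unfold squareBarrier
  gcongr

/-- As `log ‖c‖` is harmonic off the zeros of `c`, subtracting this term from `log E` leaves the
Laplacian unchanged. -/
lemma laplacian_log_two_mul_norm_sq {c : ℂ → ℂ} {z : ℂ} (hc : AnalyticAt ℂ c z) (hc0 : c z ≠ 0) :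
    ContDiffAt ℝ 2 (fun w => Real.log (2 * ‖c w‖ ^ 2)) z ∧
      Laplacian.laplacian (fun w => Real.log (2 * ‖c w‖ ^ 2)) z = 0 := by
  have hh := hc.harmonicAt_log_norm hc0
  have heq : (fun w => Real.log (2 * ‖c w‖ ^ 2)) =ᶠ[𝓝 z]
      fun w => Real.log 2 + 2 * Real.log ‖c w‖ := by
    filter_upwards [hc.continuousAt.eventually_ne hc0] with w hw
    have : ‖c w‖ ≠ 0 := norm_ne_zero_iff.2 hw
    simp [Real.log_mul, this]
  have h1 : ContDiffAt ℝ 2 (fun w => 2 * Real.log ‖c w‖) z := contDiffAt_const.mul hh.1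
  refine ⟨(contDiffAt_const.add h1).congr_of_eventuallyEq heq, ?_⟩
  rw [(InnerProductSpace.laplacian_congr_nhds heq).self_of_nhds,
    laplacian_fun_add contDiffAt_const h1, laplacian_fun_const_mul _ hh.1,
    hh.2.self_of_nhds]
  simp

/-- A solution of Wang's equation lies below the comparison function wherever the difference of the
two has a local maximum. -/
theorem le_squareBarrier_of_isLocalMax {E : ℂ → ℝ} {c W : ℂ → ℂ} {z : ℂ} {ρ : ℝ}
    (hE : ContDiffAt ℝ 2 E z) (hE0 : 0 < E z)
    (hΔ : Laplacian.laplacian (fun w => Real.log (E w)) z = 2 * E z - 4 * (‖c z‖ / E z) ^ 2)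
    (hc : AnalyticAt ℂ c z) (hc0 : c z ≠ 0) (hW : AnalyticAt ℂ W z)
    (hWc : ‖deriv W z‖ ^ 3 = ‖c z‖) (hre : |(W z).re| < ρ) (him : |(W z).im| < ρ)
    (hmax : IsLocalMax (fun y => Real.log (E y) - 1 / 3 * Real.log (2 * ‖c y‖ ^ 2) -
      squareBarrier ρ (W y)) z) :
    Real.log (E z) - 1 / 3 * Real.log (2 * ‖c z‖ ^ 2) ≤ squareBarrier ρ (W z) := by
  by_contra! hlt
  set s := Real.log (E z) - 1 / 3 * Real.log (2 * ‖c z‖ ^ 2) with hs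
  have hG := squareBarrier_pos hre him
  obtain ⟨cG, lG⟩ := laplacian_squareBarrier_comp_le hW hre him
  obtain ⟨cc, lc⟩ := laplacian_log_two_mul_norm_sq hc hc0
  have clog : ContDiffAt ℝ 2 (fun w => Real.log (E w)) z := hE.log hE0.ne'
  have cc' : ContDiffAt ℝ 2 (fun w => 1 / 3 * Real.log (2 * ‖c w‖ ^ 2)) z :=
    contDiffAt_const.mul cc
  have hlap := laplacian_nonpos_of_isLocalMax ((clog.sub cc').sub cG) hmax
  rw [laplacian_fun_sub (clog.sub cc') cG, laplacian_fun_sub clog cc',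
    laplacian_fun_const_mul _ cc, lc, mul_zero, sub_zero, hΔ] at hlap
  set m := ‖deriv W z‖ with hm
  have hm0 : 0 < m := by
    rcases (norm_nonneg (deriv W z)).eq_or_lt with h | h
    · rw [hm, ← h] at hWc
      exact absurd (norm_eq_zero.1 (by simpa using hWc.symm)) hc0
    · exact h
  rw [← hWc] at hs hlap
  set κ : ℝ := Real.exp (Real.log 2 / 3) with hκ
  have hκ3 : κ ^ 3 = 2 := by
    rw [hκ, ← Real.exp_nat_mul]
    norm_num [mul_div_cancel₀, Real.exp_log]
  have hκ1 : 1 ≤ κ := Real.one_le_exp (div_nonneg (Real.log_nonneg (by norm_num)) (by norm_num))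
  have hEs : E z = κ * m ^ 2 * Real.exp s := by
    rw [← Real.exp_log hE0, ← Real.exp_log (pow_pos hm0 2), hκ, ← Real.exp_add, ← Real.exp_add]
    congr 1
    rw [hs, Real.log_mul (by norm_num) (by positivity), Real.log_pow, Real.log_pow, Real.log_pow]
    push_cast
    ring
  have hes := Real.exp_pos s
  have hE2 : 2 * E z - 4 * (m ^ 3 / E z) ^ 2 =
      2 * κ * m ^ 2 * (Real.exp s - Real.exp (-s) * Real.exp (-s)) := by
    rw [hEs, Real.exp_neg]
    have hκ0 : κ ≠ 0 := by positivity
    field_simp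
    rw [hκ3]
    ring
  -- Positivity of the barrier gives `s > 0`, hence `e^(-2s) ≤ e^(-s)`.
  have hsinh : 2 * Real.sinh s ≤ Real.exp s - Real.exp (-s) * Real.exp (-s) := by
    have h1 : Real.exp (-s) ≤ 1 := Real.exp_le_one_iff.2 (by linarith)
    have h2 := Real.exp_pos (-s)
    rw [Real.sinh_eq]
    nlinarith
  have hmono : Real.sinh (squareBarrier ρ (W z)) < Real.sinh s := Real.sinh_lt_sinh.2 hlt
  have hsG : 0 < Real.sinh (squareBarrier ρ (W z)) := Real.sinh_pos_iff.2 hG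
  have hm2 : 0 < m ^ 2 := pow_pos hm0 2
  rw [hE2] at hlap
  have h1 : 2 * κ * m ^ 2 * (2 * Real.sinh s) ≤
      2 * κ * m ^ 2 * (Real.exp s - Real.exp (-s) * Real.exp (-s)) := by
    have : 0 < 2 * κ * m ^ 2 := by positivity
    gcongr
  -- The factor `κ ≥ 1` is dropped; the barrier is normalized for the constant `4`.
  have h2 : 1 * (4 * m ^ 2 * Real.sinh s) ≤ κ * (4 * m ^ 2 * Real.sinh s) := by
    have : 0 < 4 * m ^ 2 * Real.sinh s := by
      have := hsG.trans hmono
      positivity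
    gcongr
  have h3 : 4 * m ^ 2 * Real.sinh (squareBarrier ρ (W z)) < 4 * m ^ 2 * Real.sinh s := by
    gcongr
  linarith

end Comparison

/-! ### Sections of locally expanding maps -/

section ExpandingMap

open Metric

/-- An endomorphism of the plane which is bounded below is invertible. -/
lemma exists_continuousLinearEquiv_of_bounded_below {T : ℂ →L[ℝ] ℂ} {κ : ℝ} (hκ : 0 < κ)
    (hT : ∀ v, κ * ‖v‖ ≤ ‖T v‖) : ∃ e : ℂ ≃L[ℝ] ℂ, (e : ℂ →L[ℝ] ℂ) = T := by
  have hinj : Function.Injective (T : ℂ →ₗ[ℝ] ℂ) := by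
    rw [injective_iff_map_eq_zero]
    intro v hv
    have h1 := hT v
    have h2 : T v = 0 := hv
    rw [h2, norm_zero] at h1
    have : ‖v‖ ≤ 0 := by
      by_contra! h
      nlinarith
    exact norm_le_zero_iff.1 this
  refine ⟨(LinearEquiv.ofInjectiveEndo _ hinj).toContinuousLinearEquiv, ?_⟩
  ext v
  rfl

/-- A solution of an autonomous ordinary differential equation which exists on `[0, 1]`, because the
vector field is small compared to the size of the ball on which it is defined. -/
lemma exists_integralCurve_of_norm_le {V : ℂ → ℂ} {x₀ : ℂ} {r : ℝ} (hr : 0 ≤ r) {K : NNReal}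
    (hV : ∀ x ∈ closedBall x₀ r, ‖V x‖ ≤ r) (hK : LipschitzOnWith K V (closedBall x₀ r)) :
    ∃ γ : ℝ → ℂ, γ 0 = x₀ ∧ (∀ t, γ t ∈ closedBall x₀ r) ∧
      ∀ t ∈ Set.Icc (0 : ℝ) 1, HasDerivWithinAt γ (V (γ t)) (Set.Icc 0 1) t := by
  lift r to NNReal using hr
  have hf : IsPicardLindelof (fun _ => V) (tmin := 0) (tmax := 1) ⟨0, by simp⟩ x₀ r 0 r K :=
    .of_time_independent hV hK (by simp)
  have hx : x₀ ∈ closedBall x₀ ((0 : NNReal) : ℝ) := by simp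
  obtain ⟨α, hα⟩ := ODE.FunSpace.exists_isFixedPt_next hf hx
  refine ⟨α.compProj, ?_, fun t => α.compProj_mem_closedBall hf.mul_max_le, fun t ht => ?_⟩
  · have := ODE.FunSpace.next_apply₀ hf hx α
    rw [hα] at this
    exact (α.compProj_val (t := ⟨0, by simp⟩)).trans this
  · apply ODE.hasDerivWithinAt_picard_Icc (t₀ := 0) (by simp) hf.continuousOn_uncurry
      α.continuous_compProj.continuousOn (fun _ _ => α.compProj_mem_closedBall hf.mul_max_le)
      x₀ ht |>.congr_of_mem _ ht
    intro t' ht'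
    nth_rw 1 [← hα]
    rw [ODE.FunSpace.compProj_of_mem ht', ODE.FunSpace.next_apply]

/-- A map which expands lengths by the factor `κ` on a closed ball of radius `r` has a
continuous section on the closed ball of radius `κ r`. -/
theorem exists_section_of_expanding {w : ℂ → ℂ} {e₀ : ℂ} {r κ : ℝ} (hr : 0 ≤ r) (hκ : 0 < κ)
    (hw : ∀ e ∈ closedBall e₀ r, ContDiffAt ℝ 2 w e)
    (hexp : ∀ e ∈ closedBall e₀ r, ∀ v, κ * ‖v‖ ≤ ‖fderiv ℝ w e v‖) :
    ∃ s : ℂ → ℂ, ContinuousOn s (closedBall (w e₀) (κ * r)) ∧ s (w e₀) = e₀ ∧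
      ∀ ζ ∈ closedBall (w e₀) (κ * r), s ζ ∈ closedBall e₀ r ∧ w (s ζ) = ζ := by
  set J : ℂ → ℂ →L[ℝ] ℂ := fun e => (fderiv ℝ w e).inverse with hJ
  have hright : ∀ e ∈ closedBall e₀ r, ∀ η, fderiv ℝ w e (J e η) = η := by
    intro e he η
    obtain ⟨T, hT⟩ := exists_continuousLinearEquiv_of_bounded_below hκ (hexp e he)
    simp only [hJ, ← hT, ContinuousLinearMap.inverse_equiv]
    exact T.apply_symm_apply η
  have hbound : ∀ e ∈ closedBall e₀ r, ∀ η, ‖J e η‖ ≤ ‖η‖ / κ := by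
    intro e he η
    rw [le_div_iff₀ hκ, mul_comm]
    simpa [hright e he η] using hexp e he (J e η)
  have hJs : ∀ e ∈ closedBall e₀ r, ContDiffAt ℝ 1 J e := by
    intro e he
    obtain ⟨T, hT⟩ := exists_continuousLinearEquiv_of_bounded_below hκ (hexp e he)
    refine ContDiffAt.comp (g := ContinuousLinearMap.inverse) e ?_
      ((hw e he).fderiv_right (m := 1) (by norm_num))
    rw [← hT]
    exact contDiffAt_map_inverse T
  obtain ⟨K, hK⟩ : ∃ K, LipschitzOnWith K J (closedBall e₀ r) := by
    refine LocallyLipschitzOn.exists_lipschitzOnWith_of_compact (isCompact_closedBall _ _) ?_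
    intro e he
    obtain ⟨K, t, ht, hL⟩ := (hJs e he).exists_lipschitzOnWith
    exact ⟨K, t, mem_nhdsWithin_of_mem_nhds ht, hL⟩
  set K' : NNReal := K * (κ * r).toNNReal with hK'
  have hVL : ∀ ζ ∈ closedBall (w e₀) (κ * r),
      LipschitzOnWith K' (fun e => J e (ζ - w e₀)) (closedBall e₀ r) := by
    intro ζ hζ
    refine LipschitzOnWith.of_dist_le_mul fun x hx y hy => ?_
    have h1 := hK.dist_le_mul x hx y hy
    rw [dist_eq_norm] at h1 ⊢
    rw [← sub_apply]
    have h2 := (J x - J y).le_opNorm (ζ - w e₀)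
    have h3 : ‖ζ - w e₀‖ ≤ κ * r := by simpa [dist_eq_norm] using hζ
    have h4 : (K' : ℝ) = K * (κ * r) := by simp [hK', mul_nonneg hκ.le hr]
    rw [h4]
    calc _ ≤ _ := h2
      _ ≤ (K * dist x y) * (κ * r) := by gcongr
      _ = _ := by ring
  have hVb : ∀ ζ ∈ closedBall (w e₀) (κ * r), ∀ e ∈ closedBall e₀ r,
      ‖J e (ζ - w e₀)‖ ≤ r := by
    intro ζ hζ e he
    have h3 : ‖ζ - w e₀‖ ≤ κ * r := by simpa [dist_eq_norm] using hζ
    refine (hbound e he _).trans ?_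
    rw [div_le_iff₀ hκ, mul_comm]
    exact h3
  have hex : ∀ ζ, ∃ γ : ℝ → ℂ, ζ ∈ closedBall (w e₀) (κ * r) → γ 0 = e₀ ∧
      (∀ t, γ t ∈ closedBall e₀ r) ∧
      ∀ t ∈ Set.Icc (0 : ℝ) 1, HasDerivWithinAt γ (J (γ t) (ζ - w e₀)) (Set.Icc 0 1) t := by
    intro ζ
    by_cases hζ : ζ ∈ closedBall (w e₀) (κ * r)
    · obtain ⟨γ, h⟩ := exists_integralCurve_of_norm_le hr (hVb ζ hζ) (hVL ζ hζ)
      exact ⟨γ, fun _ => h⟩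
    · exact ⟨0, fun h => absurd h hζ⟩
  choose γ hγ using hex
  -- Along the flow of `J · (ζ - w e₀)` the image under `w` moves with constant velocity `ζ - w e₀`,
  -- so it reaches `ζ` at time one. The section sends `ζ` to this endpoint.
  have hlift : ∀ ζ ∈ closedBall (w e₀) (κ * r), ∀ t ∈ Set.Icc (0 : ℝ) 1,
      w (γ ζ t) = w e₀ + t • (ζ - w e₀) := by
    intro ζ hζ
    obtain ⟨h0, hm, hd⟩ := hγ ζ hζ
    have hd1 : ∀ t ∈ Set.Icc (0 : ℝ) 1,
        HasDerivWithinAt (fun t => w (γ ζ t)) (ζ - w e₀) (Set.Icc 0 1) t := by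
      intro t ht
      have := ((hw _ (hm t)).differentiableAt (by norm_num)).hasFDerivAt.comp_hasDerivWithinAt t
        (hd t ht)
      rwa [hright _ (hm t)] at this
    have hd2 : ∀ t ∈ Set.Icc (0 : ℝ) 1,
        HasDerivWithinAt (fun t : ℝ => w e₀ + t • (ζ - w e₀)) (ζ - w e₀) (Set.Icc 0 1) t := by
      intro t _
      simpa using (((hasDerivAt_id t).smul_const (ζ - w e₀)).const_add (w e₀)).hasDerivWithinAt
    have mono : ∀ {g : ℝ → ℂ} {g' : ℂ} {t : ℝ}, t ∈ Set.Ico (0 : ℝ) 1 →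
        HasDerivWithinAt g g' (Set.Icc 0 1) t → HasDerivWithinAt g g' (Set.Ici t) t :=
      fun ht h => h.mono_of_mem_nhdsWithin (Icc_mem_nhdsGE_of_mem ht)
    exact eq_of_has_deriv_right_eq (f' := fun _ => ζ - w e₀)
      (fun t ht => mono ht (hd1 t (Set.Ico_subset_Icc_self ht)))
      (fun t ht => mono ht (hd2 t (Set.Ico_subset_Icc_self ht)))
      (fun t ht => (hd1 t ht).continuousWithinAt) (fun t ht => (hd2 t ht).continuousWithinAt)
      (by simp [h0])
  refine ⟨fun ζ => γ ζ 1, ?_, ?_, fun ζ hζ => ⟨(hγ ζ hζ).2.1 1, by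
    simpa using hlift ζ hζ 1 (by simp)⟩⟩
  · have hgron : ∀ ζ ∈ closedBall (w e₀) (κ * r), ∀ ζ' ∈ closedBall (w e₀) (κ * r),
        dist (γ ζ' 1) (γ ζ 1) ≤ gronwallBound 0 K' (‖ζ' - ζ‖ / κ) 1 := by
      intro ζ hζ ζ' hζ'
      obtain ⟨h0, hm, hd⟩ := hγ ζ hζ
      obtain ⟨h0', hm', hd'⟩ := hγ ζ' hζ'
      have := dist_le_of_approx_trajectories_ODE_of_mem (a := 0) (b := 1) (f := γ ζ') (g := γ ζ)
        (f' := fun t => J (γ ζ' t) (ζ' - w e₀)) (g' := fun t => J (γ ζ t) (ζ - w e₀))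
        (v := fun _ e => J e (ζ - w e₀)) (s := fun _ => closedBall e₀ r) (εf := ‖ζ' - ζ‖ / κ)
        (εg := 0) (δ := 0) (K := K') (fun _ _ => hVL ζ hζ)
        (fun t ht => (hd' t ht).continuousWithinAt)
        (fun t ht => (hd' t (Set.Ico_subset_Icc_self ht)).mono_of_mem_nhdsWithin
          (Icc_mem_nhdsGE_of_mem ht))
        (fun t _ => by
          rw [dist_eq_norm, ← map_sub, sub_sub_sub_cancel_right]
          exact hbound _ (hm' t) _)
        (fun t _ => hm' t)
        (fun t ht => (hd t ht).continuousWithinAt)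
        (fun t ht => (hd t (Set.Ico_subset_Icc_self ht)).mono_of_mem_nhdsWithin
          (Icc_mem_nhdsGE_of_mem ht))
        (fun t _ => by simp) (fun t _ => hm t) (by simp [h0, h0']) 1 (by simp)
      simpa using this
    intro ζ hζ
    rw [ContinuousWithinAt, tendsto_iff_dist_tendsto_zero]
    refine squeeze_zero' (Eventually.of_forall fun _ => dist_nonneg)
      (eventually_of_mem self_mem_nhdsWithin fun ζ' hζ' => hgron ζ hζ ζ' hζ') ?_
    have hc : Continuous fun ζ' : ℂ => gronwallBound 0 K' (‖ζ' - ζ‖ / κ) 1 :=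
      (gronwallBound_continuous_ε 0 K' 1).comp (by fun_prop)
    have := (hc.tendsto ζ).mono_left (nhdsWithin_le_nhds (s := closedBall (w e₀) (κ * r)))
    simpa [gronwallBound_ε0] using this
  · have hmem : w e₀ ∈ closedBall (w e₀) (κ * r) := mem_closedBall_self (mul_nonneg hκ.le hr)
    obtain ⟨h0, hm, hd⟩ := hγ _ hmem
    -- For `ζ = w e₀` the vector field is zero.
    have : γ (w e₀) 1 = γ (w e₀) 0 := by
      refine constant_of_has_deriv_right_zero (f := γ (w e₀)) (a := 0) (b := 1)
        (fun t ht => (hd t ht).continuousWithinAt) (fun t ht => ?_) 1 (by simp)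
      have h := (hd t (Set.Ico_subset_Icc_self ht)).mono_of_mem_nhdsWithin
        (Icc_mem_nhdsGE_of_mem ht)
      simpa using h
    change γ (w e₀) 1 = e₀
    rw [this, h0]

end ExpandingMap

/-! ### The developing map of a cubic differential -/

section DevelopingMap

/-- The transition map between smooth charts is smooth. -/
lemma contDiffAt_transition {S : Type*} [TopologicalSpace S] [ChartedSpace ℂ S]
    [IsManifold 𝓘(ℝ, ℂ) ∞ S] {φ ψ : OpenPartialHomeomorph S ℂ}
    (hφ : φ ∈ IsManifold.maximalAtlas 𝓘(ℝ, ℂ) ∞ S) (hψ : ψ ∈ IsManifold.maximalAtlas 𝓘(ℝ, ℂ) ∞ S)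
    {e : ℂ} (he : e ∈ ψ.target) (heφ : ψ.symm e ∈ φ.source) :
    ContDiffAt ℝ ∞ (φ ∘ ψ.symm) e := by
  have h := StructureGroupoid.compatible_of_mem_maximalAtlas hψ hφ
  rw [contDiffGroupoid, mem_groupoid_of_pregroupoid] at h
  have h1 : ContDiffOn ℝ ∞ (φ ∘ ψ.symm) (ψ.symm.trans φ).source := by
    simpa [contDiffPregroupoid] using h.1
  exact h1.contDiffAt ((ψ.symm.trans φ).open_source.mem_nhds (by simp [he, heφ]))

/-- Factor `M³ - N³ = (M - N)(M² + MN + N²)`. The second factor equals `3 N²` at `e`, so it stays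
nonzero nearby. -/
lemma eventuallyEq_of_cube_eq {M N : ℂ → ℂ} {e : ℂ} (hM : ContinuousAt M e) (hN : ContinuousAt N e)
    (hcube : ∀ᶠ y in 𝓝 e, M y ^ 3 = N y ^ 3) (he : M e = N e) (h0 : N e ≠ 0) : M =ᶠ[𝓝 e] N := by
  have hc : ContinuousAt (fun y => M y ^ 2 + M y * N y + N y ^ 2) e := by fun_prop
  have hne : M e ^ 2 + M e * N e + N e ^ 2 ≠ 0 := by
    have : M e ^ 2 + M e * N e + N e ^ 2 = 3 * N e ^ 2 := by rw [he]; ring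
    rw [this]
    exact mul_ne_zero (by norm_num) (pow_ne_zero 2 h0)
  filter_upwards [hcube, hc.eventually_ne hne] with y h1 h2
  have h3 : (M y - N y) * (M y ^ 2 + M y * N y + N y ^ 2) = 0 := by linear_combination h1
  exact sub_eq_zero.1 ((mul_eq_zero.1 h3).resolve_right h2)

/-- Near a point where it does not vanish, a holomorphic function is the cube of the derivative of a
holomorphic function. -/
lemma exists_primitive_cubeRoot {c : ℂ → ℂ} {z₁ m : ℂ} (hc : AnalyticAt ℂ c z₁) (hm : m ^ 3 = c z₁)
    (h0 : c z₁ ≠ 0) :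
    ∃ X : ℂ → ℂ, AnalyticAt ℂ X z₁ ∧ deriv X z₁ = m ∧ ∀ᶠ z in 𝓝 z₁, deriv X z ^ 3 = c z := by
  -- The branch of the cube root with value `m` at `z₁`; the ratio `c z / c z₁` is near `1`, where
  -- the principal logarithm is holomorphic.
  set χ : ℂ → ℂ := fun z => m * Complex.exp (Complex.log (c z / c z₁) / 3) with hχ
  have hdiv : AnalyticAt ℂ (fun z => c z / c z₁) z₁ := hc.div analyticAt_const h0
  have hslit : c z₁ / c z₁ ∈ Complex.slitPlane := by simp [h0]
  have hχa : AnalyticAt ℂ χ z₁ :=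
    analyticAt_const.mul (((hdiv.clog hslit).div analyticAt_const (by norm_num)).cexp)
  obtain ⟨r, hr, hball⟩ := Metric.eventually_nhds_iff_ball.1 hχa.eventually_analyticAt
  obtain ⟨X, hX⟩ := DifferentiableOn.isExactOn_ball (f := χ) (c := z₁) (r := r)
    fun z hz => (hball z hz).differentiableAt.differentiableWithinAt
  have hball' : Metric.ball z₁ r ∈ 𝓝 z₁ := Metric.ball_mem_nhds _ hr
  have hXd : ∀ᶠ z in 𝓝 z₁, deriv X z = χ z :=
    eventually_of_mem hball' fun z hz => (hX z hz).deriv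
  refine ⟨X, ?_, ?_, ?_⟩
  · exact DifferentiableOn.analyticAt (s := Metric.ball z₁ r)
      (fun z hz => (hX z hz).differentiableAt.differentiableWithinAt) hball'
  · rw [hXd.self_of_nhds]
    simp [hχ, h0]
  · filter_upwards [hXd, hc.continuousAt.eventually_ne h0] with z h1 h2
    rw [h1]
    simp only [hχ]
    rw [mul_pow, hm, ← Complex.exp_nat_mul]
    have : ((3 : ℕ) : ℂ) * (Complex.log (c z / c z₁) / 3) = Complex.log (c z / c z₁) := by
      push_cast
      ring
    rw [this, Complex.exp_log (div_ne_zero h2 h0)]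
    field_simp

namespace CubicDifferential

variable {X : Type*} [TopologicalSpace X] {R : RiemannSurfaceStructure X} {P : Set X}

/-- The cubic differential `q` pulled back by a map `g : E → X`, as a cubic form. -/
noncomputable def cubicForm {E : Type*} [NormedAddCommGroup E] [NormedSpace ℝ E]
    (q : CubicDifferential R P) (g : E → X) (e v : E) : ℂ :=
  q.coeff (R.chart (g e)) (R.chart (g e) (g e)) * fderiv ℝ (R.chart (g e) ∘ g) e v ^ 3

lemma norm_rpow_mul_sq (a b : ℂ) :
    ‖a‖ ^ (2 / 3 : ℝ) * ‖b‖ ^ 2 = ‖a * b ^ 3‖ ^ (2 / 3 : ℝ) := by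
  rw [norm_mul, norm_pow, Real.mul_rpow (norm_nonneg _) (by positivity), ← Real.rpow_natCast _ 3,
    ← Real.rpow_mul (norm_nonneg _)]
  norm_num

variable {E : Type*} [NormedAddCommGroup E] [NormedSpace ℝ E]

lemma flatMetric_eq_norm_cubicForm (q : CubicDifferential R P) (g : E → X) (e v : E) :
    q.flatMetric g e v = ‖q.cubicForm g e v‖ ^ (2 / 3 : ℝ) :=
  norm_rpow_mul_sq _ _

end CubicDifferential

/-- Change of charts for the derivative of a map into a Riemann surface. -/
lemma RiemannSurfaceStructure.fderiv_chart_comp {X : Type*} [TopologicalSpace X]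
    {R : RiemannSurfaceStructure X} {E : Type*} [NormedAddCommGroup E] [NormedSpace ℝ E]
    {φ φ' : OpenPartialHomeomorph X ℂ} (hφ : φ ∈ R.charts)
    (hφ' : φ' ∈ R.charts) {g : E → X} {e : E} (hs : g e ∈ φ.source) (hs' : g e ∈ φ'.source)
    (hg : ContinuousAt g e) (hd : DifferentiableAt ℝ (φ ∘ g) e) (v : E) :
    fderiv ℝ (φ' ∘ g) e v = deriv (φ' ∘ φ.symm) (φ (g e)) * fderiv ℝ (φ ∘ g) e v := by
  have heq : φ' ∘ g =ᶠ[𝓝 e] (φ' ∘ φ.symm) ∘ (φ ∘ g) := by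
    filter_upwards [hg.preimage_mem_nhds (φ.open_source.mem_nhds hs)] with y hy
    simp [φ.left_inv hy]
  have hmem : φ (g e) ∈ (φ.symm.trans φ').source := by
    simp [φ.map_source hs, φ.left_inv hs, hs']
  have hd' : DifferentiableAt ℂ (φ' ∘ φ.symm) ((φ ∘ g) e) :=
    (R.holomorphic φ hφ φ' hφ').differentiableAt ((φ.symm.trans φ').open_source.mem_nhds hmem)
  rw [heq.fderiv_eq, (hd'.hasDerivAt.hasFDerivAt.restrictScalars ℝ |>.comp e
    hd.hasFDerivAt).fderiv]
  simp [mul_comm]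

/-- The chosen chart at `g e` may jump as `e` moves. This allows one fixed chart near a point, as
continuity and differentiation require. -/
lemma CubicDifferential.cubicForm_eq {X : Type*} [TopologicalSpace X]
    {R : RiemannSurfaceStructure X} {P : Set X} {E : Type*} [NormedAddCommGroup E] [NormedSpace ℝ E]
    (q : CubicDifferential R P)
    {φ : OpenPartialHomeomorph X ℂ} (hφ : φ ∈ R.charts) {g : E → X} {e : E} (hs : g e ∈ φ.source)
    (hP : g e ∉ P) (hg : ContinuousAt g e) (hd : DifferentiableAt ℝ (φ ∘ g) e) (v : E) :
    q.cubicForm g e v = q.coeff φ (φ (g e)) * fderiv ℝ (φ ∘ g) e v ^ 3 := by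
  have hs' := R.mem_chart_source (g e)
  have hmem : φ (g e) ∈ (φ.symm.trans (R.chart (g e))).source := by
    simp [φ.map_source hs, φ.left_inv hs, hs']
  rw [cubicForm, R.fderiv_chart_comp hφ (R.chart_mem _) hs hs' hg hd,
    q.transform φ hφ _ (R.chart_mem (g e)) _ hmem (by rwa [φ.left_inv hs]), φ.left_inv hs]
  ring

/-- A cubic differential without zeros on a coordinate disc is the pull-back of `dw³` by a smooth map
`w`, which is holomorphic for the complex structure. -/
theorem CubicDifferential.exists_developing_map {S : Type*} [TopologicalSpace S] [ChartedSpace ℂ S]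
    [IsManifold 𝓘(ℝ, ℂ) ∞ S] {R : RiemannSurfaceStructure S} (hR : R.IsCompatible)
    (q : HolomorphicCubicDifferential R) {ψ : OpenPartialHomeomorph S ℂ}
    (hψ : ψ ∈ IsManifold.maximalAtlas 𝓘(ℝ, ℂ) ∞ S) {e₀ : ℂ} {r : ℝ} (hr : 0 < r)
    (hball : Metric.ball e₀ r ⊆ ψ.target)
    (hq : ∀ e ∈ Metric.ball e₀ r, q.cubicForm ψ.symm e 1 ≠ 0) :
    ∃ w : ℂ → ℂ, w e₀ = 0 ∧ ∀ e ∈ Metric.ball e₀ r, ContDiffAt ℝ ∞ w e ∧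
      (∀ v, fderiv ℝ w e v ^ 3 = q.cubicForm ψ.symm e v) ∧
      AnalyticAt ℂ (w ∘ ψ ∘ (R.chart (ψ.symm e)).symm) (R.chart (ψ.symm e) (ψ.symm e)) ∧
      deriv (w ∘ ψ ∘ (R.chart (ψ.symm e)).symm) (R.chart (ψ.symm e) (ψ.symm e)) ^ 3 =
        q.coeff (R.chart (ψ.symm e)) (R.chart (ψ.symm e) (ψ.symm e)) := by
  set B := Metric.ball e₀ r with hB
  have hBo : IsOpen B := Metric.isOpen_ball
  have hcψ : ∀ e ∈ B, ContinuousAt ψ.symm e := fun e he => ψ.symm.continuousAt (hball he)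
  have hsm : ∀ e ∈ B, ∀ φ ∈ R.charts, ψ.symm e ∈ φ.source → ContDiffAt ℝ ∞ (φ ∘ ψ.symm) e :=
    fun e he φ hφ hs => contDiffAt_transition (hR hφ) hψ (hball he) hs
  have hform : ∀ e ∈ B, ∀ φ ∈ R.charts, ψ.symm e ∈ φ.source → ∀ v, q.cubicForm ψ.symm e v =
      q.coeff φ (φ (ψ.symm e)) * fderiv ℝ (φ ∘ ψ.symm) e v ^ 3 := fun e he φ hφ hs v =>
    q.cubicForm_eq hφ hs (by simp) (hcψ e he)
      ((hsm e he φ hφ hs).differentiableAt (by simp)) v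
  have hnear : ∀ e ∈ B, ∀ φ : OpenPartialHomeomorph S ℂ, ψ.symm e ∈ φ.source →
      ∀ᶠ y in 𝓝 e, y ∈ B ∧ ψ.symm y ∈ φ.source := fun e he φ hs =>
    Filter.Eventually.and (hBo.mem_nhds he) ((hcψ e he).preimage_mem_nhds (φ.open_source.mem_nhds hs))
  have hfd : ∀ e ∈ B, ∀ φ ∈ R.charts, ψ.symm e ∈ φ.source →
      ContinuousAt (fun y => fderiv ℝ (φ ∘ ψ.symm) y 1) e := fun e he φ hφ hs =>
    ((hsm e he φ hφ hs).continuousAt_fderiv (by simp)).clm_apply continuousAt_const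
  have hanal : ∀ e ∈ B, ∀ φ ∈ R.charts, ψ.symm e ∈ φ.source →
      AnalyticAt ℂ (q.coeff φ) (φ (ψ.symm e)) := fun e he φ hφ hs =>
    q.holomorphic φ hφ _ (φ.map_source hs) (by simp)
  have hcont : ContinuousOn (fun e => q.cubicForm ψ.symm e 1) B := by
    intro e he
    have hs := R.mem_chart_source (ψ.symm e)
    have hφ := R.chart_mem (ψ.symm e)
    set φ := R.chart (ψ.symm e)
    have heq : (fun e => q.cubicForm ψ.symm e 1) =ᶠ[𝓝 e] fun y =>
        q.coeff φ ((φ ∘ ψ.symm) y) * fderiv ℝ (φ ∘ ψ.symm) y 1 ^ 3 := by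
      filter_upwards [hnear e he φ hs] with y hy using hform y hy.1 φ hφ hy.2 1
    refine ContinuousAt.continuousWithinAt (ContinuousAt.congr ?_ heq.symm)
    have h1 : ContinuousAt (fun y => q.coeff φ ((φ ∘ ψ.symm) y)) e :=
      ContinuousAt.comp (g := q.coeff φ) (hanal e he φ hφ hs).continuousAt
        (hsm e he φ hφ hs).continuousAt
    exact h1.mul ((hfd e he φ hφ hs).pow 3)
  have hsc : IsSimplyConnected B := by
    have := (convex_ball e₀ r).contractibleSpace ⟨e₀, Metric.mem_ball_self hr⟩
    exact SimplyConnectedSpace.ofContractible B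
  obtain ⟨κ, hκc, hκ⟩ := Complex.exists_continuousOn_pow_eq hsc hBo hcont
    (by rintro ⟨e, he, h⟩; exact hq e he h) (n := 3) (by norm_num)
  set D : ℂ → ℂ →L[ℝ] ℂ := fun e => fderiv ℝ (R.chart (ψ.symm e) ∘ ψ.symm) e with hD
  -- The cube root of the cubic form as a complex-valued 1-form, normalized by `θ e 1 = κ e`. A
  -- change of chart multiplies `D e` by a scalar, which cancels.
  set θ : ℂ → ℂ →L[ℝ] ℂ := fun e => (κ e / D e 1) • D e with hθ
  have hD1 : ∀ e ∈ B, D e 1 ≠ 0 := fun e he h => by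
    apply hq e he
    have : q.cubicForm ψ.symm e 1 = _ * D e 1 ^ 3 := rfl
    rw [this, h]
    simp
  have hθcube : ∀ e ∈ B, ∀ v, θ e v ^ 3 = q.cubicForm ψ.symm e v := by
    intro e he v
    have h1 := hκ e
    have h2 : q.cubicForm ψ.symm e 1 =
      q.coeff (R.chart (ψ.symm e)) (R.chart (ψ.symm e) (ψ.symm e)) * D e 1 ^ 3 := rfl
    have h3 : q.cubicForm ψ.symm e v =
      q.coeff (R.chart (ψ.symm e)) (R.chart (ψ.symm e) (ψ.symm e)) * D e v ^ 3 := rfl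
    have h4 := hD1 e he
    rw [h3, hθ]
    simp only [smul_apply, smul_eq_mul]
    rw [mul_pow, div_pow, h1, h2]
    field_simp
  -- locally, the form has a holomorphic primitive
  have hloc : ∀ e ∈ B, ∃ Y : ℂ → ℂ, AnalyticAt ℂ Y (R.chart (ψ.symm e) (ψ.symm e)) ∧
      deriv Y (R.chart (ψ.symm e) (ψ.symm e)) ^ 3 =
        q.coeff (R.chart (ψ.symm e)) (R.chart (ψ.symm e) (ψ.symm e)) ∧
      ContDiffAt ℝ ∞ (Y ∘ R.chart (ψ.symm e) ∘ ψ.symm) e ∧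
      θ =ᶠ[𝓝 e] fderiv ℝ (Y ∘ R.chart (ψ.symm e) ∘ ψ.symm) := by
    intro e he
    have hs := R.mem_chart_source (ψ.symm e)
    have hφ := R.chart_mem (ψ.symm e)
    have hDe : D e = fderiv ℝ (R.chart (ψ.symm e) ∘ ψ.symm) e := rfl
    set φ := R.chart (ψ.symm e)
    set g : ℂ → ℂ := φ ∘ ψ.symm with hg
    have hgs : ContDiffAt ℝ ∞ g e := hsm e he φ hφ hs
    have hc := hanal e he φ hφ hs
    set M : ℂ → ℂ := fun y => κ y / fderiv ℝ g y 1 with hM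
    have hg1 : ∀ y ∈ B, ψ.symm y ∈ φ.source → fderiv ℝ g y 1 ≠ 0 := by
      intro y hy hys h
      apply hq y hy
      rw [hform y hy φ hφ hys, h]
      simp
    have hMcube : ∀ y ∈ B, ψ.symm y ∈ φ.source → M y ^ 3 = q.coeff φ (g y) := by
      intro y hy hys
      simp only [hM]
      have h4 := hg1 y hy hys
      rw [div_pow, hκ, hform y hy φ hφ hys]
      exact mul_div_cancel_right₀ _ (pow_ne_zero 3 h4)
    have hc0 : q.coeff φ (g e) ≠ 0 := by
      intro h
      apply hq e he
      rw [hform e he φ hφ hs]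
      change q.coeff φ (g e) * _ = 0
      rw [h, zero_mul]
    obtain ⟨Y, hY, hYm, hYc⟩ := exists_primitive_cubeRoot (m := M e) hc (hMcube e he hs) hc0
    have hYg : ContDiffAt ℝ ∞ (Y ∘ g) e :=
      ContDiffAt.comp e (hY.contDiffAt.restrict_scalars ℝ) hgs
    refine ⟨Y, hY, hYc.self_of_nhds, hYg, ?_⟩
    have hMc : ContinuousAt M e :=
      ((hκc e he).continuousAt (hBo.mem_nhds he)).div (hfd e he φ hφ hs) (hg1 e he hs)
    have hYdc : ContinuousAt (fun y => deriv Y (g y)) e :=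
      ContinuousAt.comp (g := deriv Y) hY.deriv.continuousAt hgs.continuousAt
    have hMY : M =ᶠ[𝓝 e] fun y => deriv Y (g y) := by
      refine eventuallyEq_of_cube_eq hMc hYdc ?_ hYm.symm ?_
      · filter_upwards [hnear e he φ hs, hgs.continuousAt.eventually hYc] with y h1 h2
        rw [hMcube y h1.1 h1.2, h2]
      · intro h
        have := hYc.self_of_nhds
        rw [show φ (ψ.symm e) = g e from rfl, h] at this
        exact hc0 (by rw [← this]; simp)
    filter_upwards [hnear e he φ hs, hMY, hgs.continuousAt.eventually hY.eventually_analyticAt]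
      with y hy hyM hyY
    have hgd : DifferentiableAt ℝ g y := (hsm y hy.1 φ hφ hy.2).differentiableAt (by simp)
    have hch : ∀ v, D y v = deriv (R.chart (ψ.symm y) ∘ φ.symm) (g y) * fderiv ℝ g y v := fun v =>
      R.fderiv_chart_comp hφ (R.chart_mem _) hy.2 (R.mem_chart_source _) (hcψ y hy.1) hgd v
    ext1 v
    have h1 := hD1 y hy.1
    have hfY : fderiv ℝ (Y ∘ g) y v = deriv Y (g y) * fderiv ℝ g y v := by
      rw [(hyY.differentiableAt.hasDerivAt.hasFDerivAt.restrictScalars ℝ |>.comp y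
        hgd.hasFDerivAt).fderiv]
      simp [mul_comm]
    have h2 : fderiv ℝ (Y ∘ φ ∘ ψ.symm) y v = _ := hfY
    rw [h2, ← hyM]
    simp only [hθ, hM, smul_apply, smul_eq_mul]
    have h3 := hg1 y hy.1 hy.2
    rw [hch v, hch 1]
    have h4 : deriv (R.chart (ψ.symm y) ∘ φ.symm) (g y) ≠ 0 := by
      intro h
      rw [hch, h, zero_mul] at h1
      exact h1 rfl
    field_simp
  -- The Poincaré lemma on the disc; `θ` is closed because it is locally the differential of some `Y
  -- ∘ φ ∘ ψ.symm`.
  obtain ⟨w₀, hw₀⟩ : ∃ w, ∀ e ∈ B, HasFDerivAt w (θ e) e :=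
    (convex_ball e₀ r).exists_forall_hasFDerivAt_of_fderiv_symmetric hBo
    (fun e he => by
      obtain ⟨Y, -, -, hYs, hYθ⟩ := hloc e he
      exact (((hYs.of_le two_le_smooth).fderiv_right (m := 1) (by norm_num)).differentiableAt
        (by simp)).congr_of_eventuallyEq hYθ |>.differentiableWithinAt)
    (fun e he x y => by
      obtain ⟨Y, -, -, hYs, hYθ⟩ := hloc e he
      rw [hYθ.fderiv_eq]
      exact hYs.isSymmSndFDerivAt (by simp [two_le_smooth]) x y)
  set w : ℂ → ℂ := fun e => w₀ e - w₀ e₀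
  have hw : ∀ e ∈ B, HasFDerivAt w (θ e) e := fun e he => (hw₀ e he).sub_const _
  refine ⟨w, sub_self _, fun e he => ?_⟩
  obtain ⟨Y, hY, hYc, hYs, hYθ⟩ := hloc e he
  have hs := R.mem_chart_source (ψ.symm e)
  set φ := R.chart (ψ.symm e)
  -- Up to a constant, `w` is locally the holomorphic primitive `Y`, so it is holomorphic in the
  -- complex chart although it was built in the smooth one.
  obtain ⟨C, hC⟩ : ∃ C, w =ᶠ[𝓝 e] fun y => (Y ∘ φ ∘ ψ.symm) y + C := by
    have h1 : ∀ᶠ y in 𝓝 e, y ∈ B ∧ θ y = fderiv ℝ (Y ∘ φ ∘ ψ.symm) y ∧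
        DifferentiableAt ℝ (Y ∘ φ ∘ ψ.symm) y := by
      filter_upwards [hBo.mem_nhds he, hYθ, (hYs.of_le two_le_smooth).eventually (by simp)]
        with y h1 h2 h3 using ⟨h1, h2, h3.differentiableAt (by simp)⟩
    obtain ⟨δ, hδ, hδb⟩ := Metric.eventually_nhds_iff_ball.1 h1
    obtain ⟨C, hC⟩ := Metric.isOpen_ball.exists_eq_add_of_fderiv_eq (𝕜 := ℝ) (f := w)
      (g := Y ∘ φ ∘ ψ.symm) (convex_ball e δ).isPreconnected
      (fun y hy => (hw y (hδb y hy).1).differentiableAt.differentiableWithinAt)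
      (fun y hy => (hδb y hy).2.2.differentiableWithinAt)
      (fun y hy => by rw [(hw y (hδb y hy).1).fderiv, (hδb y hy).2.1])
    exact ⟨C, eventually_of_mem (Metric.ball_mem_nhds e hδ) hC⟩
  have hW : w ∘ ψ ∘ φ.symm =ᶠ[𝓝 (φ (ψ.symm e))] fun z => Y z + C := by
    have hleft : φ.symm (φ (ψ.symm e)) = ψ.symm e := φ.left_inv hs
    have h1 : ContinuousAt φ.symm (φ (ψ.symm e)) := φ.symm.continuousAt (φ.map_source hs)
    have h2 : ContinuousAt ψ (φ.symm (φ (ψ.symm e))) := by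
      rw [hleft]
      exact ψ.continuousAt (ψ.map_target (hball he))
    have h3 : Tendsto (fun z => ψ (φ.symm z)) (𝓝 (φ (ψ.symm e))) (𝓝 e) := by
      have := (h2.comp h1).tendsto
      simp only [Function.comp_apply, hleft, ψ.right_inv (hball he)] at this
      exact this
    have h4 : ∀ᶠ z in 𝓝 (φ (ψ.symm e)), φ.symm z ∈ ψ.source :=
      h1.preimage_mem_nhds (ψ.open_source.mem_nhds (by
        rw [hleft]
        exact ψ.map_target (hball he)))
    filter_upwards [h3.eventually hC, h4, φ.open_target.mem_nhds (φ.map_source hs)]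
      with z hz1 hz2 hz3
    simp only [Function.comp_apply] at hz1 ⊢
    rw [hz1, ψ.left_inv hz2, φ.right_inv hz3]
  refine ⟨(hYs.add contDiffAt_const).congr_of_eventuallyEq hC, fun v => ?_, ?_, ?_⟩
  · rw [(hw e he).fderiv]
    exact hθcube e he v
  · exact (hY.add analyticAt_const).congr hW.symm
  · rw [hW.deriv_eq, deriv_add_const, hYc]

end DevelopingMap

/-! ### The local estimate -/

section LocalEstimate

variable {S : Type*} [TopologicalSpace S] {R : RiemannSurfaceStructure S}

/-- Wang's equation in a chart. -/
lemma IsBlaschke.wang_equation {q : HolomorphicCubicDifferential R} {σ : HyperbolicMetric R}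
    {u : S → ℝ} (hu : IsBlaschke q σ u) {φ : OpenPartialHomeomorph S ℂ} (hφ : φ ∈ R.charts) {z : ℂ}
    (hz : z ∈ φ.target) :
    ContDiffAt ℝ ∞ (fun y => Real.exp (u (φ.symm y)) * σ.density φ y) z ∧
    Laplacian.laplacian (fun w => Real.log (Real.exp (u (φ.symm w)) * σ.density φ w)) z =
      2 * (Real.exp (u (φ.symm z)) * σ.density φ z) -
        4 * (‖q.coeff φ z‖ / (Real.exp (u (φ.symm z)) * σ.density φ z)) ^ 2 := by
  obtain ⟨U, hU, hzU, -, f, Γ, hf, hq⟩ := hu φ hφ z hz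
  have hpos : 0 < Real.exp (u (φ.symm z)) * σ.density φ z :=
    mul_pos (Real.exp_pos _) (σ.pos φ hφ z hz)
  have hw := IsHyperbolicAffineSphere.wang_equation
    (E := fun y => Real.exp (u (φ.symm y)) * σ.density φ y) hU hf hzU
  refine ⟨hw.1, hw.2.trans ?_⟩
  rw [hq z hzU, norm_mul, Complex.norm_real, Real.norm_of_nonneg hpos.le,
    mul_div_cancel_left₀ _ hpos.ne']

/-- The expression does not depend on the chart, because `|q|²` and `σ³` both scale by the sixth
power of the norm of the derivative of the transition map. -/
lemma logDensityDifference_eq (q : HolomorphicCubicDifferential R) (σ : HyperbolicMetric R)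
    (u : S → ℝ) {φ : OpenPartialHomeomorph S ℂ} (hφ : φ ∈ R.charts) {x : S} (hx : x ∈ φ.source)
    (h0 : q.coeff φ (φ x) ≠ 0) :
    logDensityDifference q σ u x = 3 / 2 * (Real.log (Real.exp (u x) * σ.density φ (φ x)) -
      1 / 3 * Real.log (2 * ‖q.coeff φ (φ x)‖ ^ 2)) := by
  have hx' := R.mem_chart_source x
  have hmem : φ x ∈ (φ.symm.trans (R.chart x)).source := by
    simp [φ.map_source hx, φ.left_inv hx, hx']
  have h1 := q.transform φ hφ _ (R.chart_mem x) _ hmem (by simp)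
  have h2 := σ.transform φ hφ _ (R.chart_mem x) _ hmem
  rw [φ.left_inv hx] at h1 h2
  rw [h1] at h0
  have hc : ‖q.coeff (R.chart x) (R.chart x x)‖ ≠ 0 := norm_ne_zero_iff.2 (left_ne_zero_of_mul h0)
  have hd : ‖deriv (R.chart x ∘ φ.symm) (φ x)‖ ≠ 0 :=
    norm_ne_zero_iff.2 (ne_zero_pow (by norm_num) (right_ne_zero_of_mul h0))
  have hσ := (σ.pos _ (R.chart_mem x) _ ((R.chart x).map_source hx')).ne'
  rw [logDensityDifference, h1, h2, norm_mul, norm_pow, Real.log_div (by positivity) (by positivity),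
    Real.log_mul (by positivity) (by positivity), Real.log_mul (by positivity) (by positivity),
    Real.log_mul (by positivity) (by positivity), Real.log_mul (by positivity) (by positivity),
    mul_pow, Real.log_mul (by positivity) (by positivity)]
  simp only [Real.log_pow, Real.log_exp]
  push_cast
  ring

lemma eventually_logDensityDifference_eq (q : HolomorphicCubicDifferential R)
    (σ : HyperbolicMetric R) (u : S → ℝ) {φ : OpenPartialHomeomorph S ℂ} (hφ : φ ∈ R.charts)
    {z : ℂ} (hz : z ∈ φ.target) (h0 : q.coeff φ z ≠ 0) :
    ∀ᶠ y in 𝓝 z, logDensityDifference q σ u (φ.symm y) =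
      3 / 2 * (Real.log (Real.exp (u (φ.symm y)) * σ.density φ y) -
        1 / 3 * Real.log (2 * ‖q.coeff φ y‖ ^ 2)) := by
  have hc := (q.holomorphic φ hφ z hz (by simp)).continuousAt
  filter_upwards [φ.open_target.mem_nhds hz, hc.eventually_ne h0] with y hy hy0
  have := logDensityDifference_eq q σ u hφ (φ.map_target hy) (by rwa [φ.right_inv hy])
  rwa [φ.right_inv hy] at this

/-- Continuity of `u` is not assumed; it enters through the smoothness of `e^u σ` obtained from the
affine sphere. -/
lemma IsBlaschke.continuousAt_logDensityDifference {q : HolomorphicCubicDifferential R}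
    {σ : HyperbolicMetric R} {u : S → ℝ} (hu : IsBlaschke q σ u) {x : S}
    (h0 : q.coeff (R.chart x) (R.chart x x) ≠ 0) :
    ContinuousAt (logDensityDifference q σ u) x := by
  have hx := R.mem_chart_source x
  have hφ := R.chart_mem x
  set φ := R.chart x
  have hz := φ.map_source hx
  have hE := (hu.wang_equation hφ hz).1.continuousAt
  have hpos : 0 < Real.exp (u (φ.symm (φ x))) * σ.density φ (φ x) :=
    mul_pos (Real.exp_pos _) (σ.pos φ hφ _ hz)
  have hc := (q.holomorphic φ hφ _ hz (by simp)).continuousAt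
  have hn : 2 * ‖q.coeff φ (φ x)‖ ^ 2 ≠ 0 := by
    have := norm_ne_zero_iff.2 h0
    positivity
  have h1 : ContinuousAt (fun y => logDensityDifference q σ u (φ.symm y)) (φ x) := by
    refine ContinuousAt.congr ?_ (EventuallyEq.symm
      (eventually_logDensityDifference_eq q σ u hφ hz h0))
    exact continuousAt_const.mul ((hE.log hpos.ne').sub (continuousAt_const.mul
      ((continuousAt_const.mul (hc.norm.pow 2)).log hn)))
  refine ContinuousAt.congr (ContinuousAt.comp (g := fun y => logDensityDifference q σ u (φ.symm y))
    h1 (φ.continuousAt hx)) ?_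
  filter_upwards [φ.open_source.mem_nhds hx] with y hy
  simp [φ.left_inv hy]

/-- The difference of a continuous function and the comparison function on a square attains its
maximum. -/
lemma exists_max_sub_squareBarrier {f : ℂ → ℝ} {ρ : ℝ} (hρ : 0 < ρ)
    (hf : ContinuousOn f {ζ | |ζ.re| ≤ ρ ∧ |ζ.im| ≤ ρ}) :
    ∃ ζ₁ : ℂ, |ζ₁.re| < ρ ∧ |ζ₁.im| < ρ ∧ ∀ ζ : ℂ, |ζ.re| < ρ → |ζ.im| < ρ →
      f ζ - squareBarrier ρ ζ ≤ f ζ₁ - squareBarrier ρ ζ₁ := by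
  have hcomp : ∀ t : ℝ, IsCompact {ζ : ℂ | |ζ.re| ≤ t ∧ |ζ.im| ≤ t} := by
    intro t
    have := (isCompact_Icc (a := -t) (b := t)).reProdIm (isCompact_Icc (a := -t) (b := t))
    convert this using 1
    ext ζ
    simp [Complex.mem_reProdIm, abs_le]
  obtain ⟨M, hM⟩ := ((hcomp ρ).image_of_continuousOn hf).bddAbove
  have hM' : ∀ ζ : ℂ, |ζ.re| < ρ → |ζ.im| < ρ → f ζ ≤ M := fun ζ h1 h2 =>
    hM ⟨ζ, ⟨h1.le, h2.le⟩, rfl⟩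
  obtain ⟨δ, hδ, hbig⟩ : ∃ δ > 0, ∀ x, 0 < x → x < δ →
      M - (f 0 - squareBarrier ρ 0) ≤ cothBarrier x := by
    have := tendsto_cothBarrier.eventually_ge_atTop (M - (f 0 - squareBarrier ρ 0))
    obtain ⟨δ, hδ, h⟩ := mem_nhdsGT_iff_exists_Ioo_subset.1 this
    exact ⟨δ, hδ, fun x h1 h2 => h ⟨h1, h2⟩⟩
  -- Outside the square of half side `t`, some side is closer than `δ`. The barrier term of that
  -- side alone brings the difference below its value at `0`.
  set t := ρ - min (δ / 2) (ρ / 2) with ht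
  have hmin1 : 0 < min (δ / 2) (ρ / 2) := by positivity
  have hmin2 := min_le_left (δ / 2) (ρ / 2)
  have hmin3 := min_le_right (δ / 2) (ρ / 2)
  have ht0 : 0 ≤ t := by linarith
  have htρ : t < ρ := by linarith
  have hcont : ContinuousOn (fun ζ => f ζ - squareBarrier ρ ζ) {ζ | |ζ.re| ≤ t ∧ |ζ.im| ≤ t} := by
    intro ζ hζ
    refine ((hf ζ ⟨hζ.1.trans htρ.le, hζ.2.trans htρ.le⟩).mono fun η hη =>
      ⟨hη.1.trans htρ.le, hη.2.trans htρ.le⟩).sub ?_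
    exact (laplacian_squareBarrier_comp_le (W := id) analyticAt_id (hζ.1.trans_lt htρ)
      (hζ.2.trans_lt htρ)).1.continuousAt.continuousWithinAt
  have h0 : (0 : ℂ) ∈ {ζ : ℂ | |ζ.re| ≤ t ∧ |ζ.im| ≤ t} := by simp [ht0]
  obtain ⟨ζ₁, hζ₁, hmax⟩ := (hcomp t).exists_isMaxOn ⟨0, h0⟩ hcont
  refine ⟨ζ₁, hζ₁.1.trans_lt htρ, hζ₁.2.trans_lt htρ, fun ζ h1 h2 => ?_⟩
  by_cases hζ : ζ ∈ {ζ : ℂ | |ζ.re| ≤ t ∧ |ζ.im| ≤ t}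
  · exact hmax hζ
  · refine le_trans ?_ (hmax h0)
    have hfM := hM' ζ h1 h2
    suffices M - (f 0 - squareBarrier ρ 0) ≤ squareBarrier ρ ζ by
      change f ζ - squareBarrier ρ ζ ≤ f 0 - squareBarrier ρ 0
      linarith
    have hζ' : t < |ζ.re| ∨ t < |ζ.im| := by
      by_contra! h
      exact hζ h
    rw [abs_lt] at h1 h2
    have p1 := cothBarrier_pos (x := ρ + ζ.re) (by linarith)
    have p2 := cothBarrier_pos (x := ρ - ζ.re) (by linarith)
    have p3 := cothBarrier_pos (x := ρ + ζ.im) (by linarith)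
    have p4 := cothBarrier_pos (x := ρ - ζ.im) (by linarith)
    unfold squareBarrier at *
    rcases hζ' with h | h <;> rcases lt_abs.1 h with h | h
    · have := hbig (ρ - ζ.re) (by linarith) (by linarith)
      linarith
    · have := hbig (ρ + ζ.re) (by linarith) (by linarith)
      linarith
    · have := hbig (ρ - ζ.im) (by linarith) (by linarith)
      linarith
    · have := hbig (ρ + ζ.im) (by linarith) (by linarith)
      linarith

/-- On a coordinate disc of radius larger than `r` on which the flat metric `|q|^(2/3)` is at least
`κ²` times the coordinate metric, the difference of logarithmic densities at the centre is bounded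
by the value of the comparison function at the centre of a square of half side `κ r / 2`. -/
theorem IsBlaschke.logDensityDifference_le [ChartedSpace ℂ S] [IsManifold 𝓘(ℝ, ℂ) ∞ S]
    (hR : R.IsCompatible) {q : HolomorphicCubicDifferential R}
    {σ : HyperbolicMetric R} {u : S → ℝ} (hu : IsBlaschke q σ u) {ψ : OpenPartialHomeomorph S ℂ}
    (hψ : ψ ∈ IsManifold.maximalAtlas 𝓘(ℝ, ℂ) ∞ S) {e₀ : ℂ} {r r' κ : ℝ} (hr : 0 < r)
    (hrr' : r < r') (hκ : 0 < κ) (hball : Metric.ball e₀ r' ⊆ ψ.target)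
    (hflat : ∀ e ∈ Metric.ball e₀ r', ∀ v, κ ^ 2 * ‖v‖ ^ 2 ≤ q.flatMetric ψ.symm e v) :
    logDensityDifference q σ u (ψ.symm e₀) ≤ 6 * cothBarrier (κ * r / 2) := by
  have hform : ∀ e ∈ Metric.ball e₀ r', q.cubicForm ψ.symm e 1 ≠ 0 := by
    intro e he h
    have := hflat e he 1
    rw [q.flatMetric_eq_norm_cubicForm, h, norm_zero, Real.zero_rpow (by norm_num)] at this
    simp at this
    nlinarith [pow_pos hκ 2]
  obtain ⟨w, hw0, hw⟩ := q.exists_developing_map hR hψ (hr.trans hrr') hball hform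
  have hsub : Metric.closedBall e₀ r ⊆ Metric.ball e₀ r' := Metric.closedBall_subset_ball hrr'
  have hexp : ∀ e ∈ Metric.ball e₀ r', ∀ v, κ * ‖v‖ ≤ ‖fderiv ℝ w e v‖ := by
    intro e he v
    have h1 := hflat e he v
    rw [q.flatMetric_eq_norm_cubicForm, ← (hw e he).2.1 v, ← one_mul (fderiv ℝ w e v ^ 3),
      ← CubicDifferential.norm_rpow_mul_sq, norm_one, Real.one_rpow, one_mul, ← mul_pow] at h1
    exact le_of_sq_le_sq h1 (norm_nonneg _)
  obtain ⟨s, hsc, hs0, hs⟩ := exists_section_of_expanding hr.le hκ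
    (fun e he => (hw e (hsub he)).1.of_le two_le_smooth) (fun e he => hexp e (hsub he))
  rw [hw0] at hsc hs0 hs
  -- By `|ζ| ≤ |Re ζ| + |Im ζ|`, half of `κ r` makes the square fit into the disc on which the
  -- section is defined.
  set ρ := κ * r / 2 with hρ
  have hρ0 : 0 < ρ := by positivity
  have hsq : ∀ ζ : ℂ, |ζ.re| ≤ ρ → |ζ.im| ≤ ρ → ζ ∈ Metric.closedBall (0 : ℂ) (κ * r) := by
    intro ζ h1 h2
    rw [mem_closedBall_zero_iff]
    have := Complex.norm_le_abs_re_add_abs_im ζ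
    linarith
  have hcoeff : ∀ e ∈ Metric.ball e₀ r',
      q.coeff (R.chart (ψ.symm e)) (R.chart (ψ.symm e) (ψ.symm e)) ≠ 0 := fun e he =>
    left_ne_zero_of_mul (hform e he)
  set F := logDensityDifference q σ u with hF
  -- The factor `2 / 3` undoes the `3 / 2` in `F` and leaves the function `s` to be compared with
  -- the barrier.
  have hFc : ContinuousOn (fun ζ => 2 / 3 * F (ψ.symm (s ζ))) {ζ | |ζ.re| ≤ ρ ∧ |ζ.im| ≤ ρ} := by
    intro ζ hζ
    have hmem := hsq ζ hζ.1 hζ.2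
    have he := hsub (hs ζ hmem).1
    have h1 : ContinuousWithinAt s {ζ | |ζ.re| ≤ ρ ∧ |ζ.im| ≤ ρ} ζ :=
      (hsc ζ hmem).mono fun η hη => hsq η hη.1 hη.2
    have h2 : ContinuousAt (fun e => F (ψ.symm e)) (s ζ) :=
      ContinuousAt.comp (g := F) (hu.continuousAt_logDensityDifference (hcoeff _ he))
        (ψ.symm.continuousAt (hball he))
    exact continuousWithinAt_const.mul (h2.comp_continuousWithinAt h1)
  obtain ⟨ζ₁, hre, him, hmax⟩ := exists_max_sub_squareBarrier hρ0 hFc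
  have hζ₁ := hsq ζ₁ hre.le him.le
  obtain ⟨he₁', hwe⟩ := hs ζ₁ hζ₁
  set e₁ := s ζ₁ with he₁
  have heB := hsub he₁'
  have heT := hball heB
  obtain ⟨hw1, -, hWa, hWd⟩ := hw e₁ heB
  have hc0 := hcoeff e₁ heB
  have hx := R.mem_chart_source (ψ.symm e₁)
  have hφ := R.chart_mem (ψ.symm e₁)
  set x₁ := ψ.symm e₁ with hx₁
  set φ := R.chart x₁
  have hz := φ.map_source hx
  have hleft : φ.symm (φ x₁) = x₁ := φ.left_inv hx
  have hWz : (w ∘ ψ ∘ φ.symm) (φ x₁) = ζ₁ := by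
    simp only [Function.comp_apply, hleft]
    rw [hx₁, ψ.right_inv heT, hwe]
  -- the section inverts `w` near `e₁`
  have hopen : IsOpen {ζ : ℂ | |ζ.re| < ρ ∧ |ζ.im| < ρ} :=
    (isOpen_lt Complex.continuous_re.abs continuous_const).inter
      (isOpen_lt Complex.continuous_im.abs continuous_const)
  have hnhds : {ζ : ℂ | |ζ.re| < ρ ∧ |ζ.im| < ρ} ∈ 𝓝 ζ₁ := hopen.mem_nhds ⟨hre, him⟩
  have hscat : ContinuousAt s ζ₁ := hsc.continuousAt
    (mem_of_superset hnhds fun ζ hζ => hsq ζ hζ.1.le hζ.2.le)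
  have hwt : Tendsto w (𝓝 e₁) (𝓝 ζ₁) := by
    have := hw1.continuousAt.tendsto
    rwa [hwe] at this
  have hinv : ∀ᶠ e in 𝓝 e₁, s (w e) = e := by
    obtain ⟨T, hT⟩ := exists_continuousLinearEquiv_of_bounded_below hκ (hexp e₁ heB)
    have hstrict : HasStrictFDerivAt w (T : ℂ →L[ℝ] ℂ) e₁ := by
      rw [hT]
      exact hw1.hasStrictFDerivAt (by simp)
    have h1 := hstrict.eventually_left_inverse
    have h2 : Tendsto (fun e => s (w e)) (𝓝 e₁) (𝓝 e₁) := hscat.tendsto.comp hwt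
    filter_upwards [h1, h2.eventually h1, hwt.eventually hnhds] with e h3 h4 h5
    rw [(hs _ (hsq _ h5.1.le h5.2.le)).2] at h4
    rw [← h4, h3]
  have hψφ : Tendsto (fun z => ψ (φ.symm z)) (𝓝 (φ x₁)) (𝓝 e₁) := by
    have h1 : ContinuousAt φ.symm (φ x₁) := φ.symm.continuousAt hz
    have h2 : ContinuousAt ψ (φ.symm (φ x₁)) := by
      rw [hleft]
      exact ψ.continuousAt (ψ.map_target heT)
    have h3 : ψ (φ.symm (φ x₁)) = e₁ := by rw [hleft, hx₁, ψ.right_inv heT]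
    have := (h2.comp h1).tendsto
    rwa [Function.comp_apply, h3] at this
  have hψs : ∀ᶠ z in 𝓝 (φ x₁), φ.symm z ∈ ψ.source :=
    (φ.symm.continuousAt hz).preimage_mem_nhds (ψ.open_source.mem_nhds (by
      rw [hleft]
      exact ψ.map_target heT))
  have hloc := eventually_logDensityDifference_eq q σ u hφ hz hc0
  rw [← hF] at hloc
  -- The maximum found on the square becomes a local maximum in the complex chart, because `s ∘ w`
  -- is the identity near `e₁`.
  have hlocmax : IsLocalMax (fun y => Real.log (Real.exp (u (φ.symm y)) * σ.density φ y) -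
      1 / 3 * Real.log (2 * ‖q.coeff φ y‖ ^ 2) - squareBarrier ρ ((w ∘ ψ ∘ φ.symm) y)) (φ x₁) := by
    have hself := hloc.self_of_nhds
    filter_upwards [hloc, hψφ.eventually hinv, hψφ.eventually (hwt.eventually hnhds), hψs]
      with y h1 h2 h3 h4
    have h5 := hmax _ h3.1 h3.2
    rw [h2, ψ.left_inv h4] at h5
    rw [hleft] at hself ⊢
    rw [hWz]
    simp only [Function.comp_apply]
    linarith
  have hE := hu.wang_equation hφ hz
  have hle := le_squareBarrier_of_isLocalMax (hE.1.of_le two_le_smooth)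
    (mul_pos (Real.exp_pos _) (σ.pos φ hφ _ hz)) hE.2 (q.holomorphic φ hφ _ hz (by simp)) hc0 hWa
    (by rw [← norm_pow, hWd]) (by rwa [hWz]) (by rwa [hWz]) hlocmax
  have hself := hloc.self_of_nhds
  have h0 := hmax 0 (by simpa using hρ0) (by simpa using hρ0)
  rw [hs0] at h0
  rw [hWz] at hle
  rw [hleft] at hself hle
  -- The centre is at distance `ρ` from all four sides; the constant of the conclusion is `6 = (3 /
  -- 2) · 4`.
  have hb0 : squareBarrier ρ 0 = 4 * cothBarrier ρ := by
    simp [squareBarrier]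
    ring
  rw [hb0] at h0
  linarith

end LocalEstimate

section Limit

namespace CubicDifferential

variable {X : Type*} [TopologicalSpace X] {R : RiemannSurfaceStructure X} {P : Set X}

lemma flatDist_self (q : CubicDifferential R P) (x : X) : q.flatDist x x = 0 := by
  have hpath : IsPiecewiseC1Path R (fun _ : ℝ => x) ∧ x = x ∧ x = x :=
    ⟨⟨continuousOn_const, ∅, Set.finite_empty, fun t _ φ _ _ =>
      (contDiffAt_const : ContDiffAt ℝ 1 (fun _ : ℝ => φ x) t)⟩, rfl, rfl⟩
  have hmetric : ∀ t : ℝ, q.flatMetric (fun _ : ℝ => x) t 1 = 0 := fun t => by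
    have hc : (R.chart x ∘ fun _ : ℝ => x) = fun _ => R.chart x x := rfl
    simp [flatMetric, hc]
  have hlen : q.pathLength (fun _ : ℝ => x) = 0 := by
    simp [pathLength, hmetric]
  have hle : q.flatDist x x ≤ q.pathLength (fun _ : ℝ => x) :=
    iInf₂_le (f := fun (γ : ℝ → X) (_ : IsPiecewiseC1Path R γ ∧ γ 0 = x ∧ γ 1 = x) =>
      q.pathLength γ) (fun _ : ℝ => x) hpath
  exact le_antisymm (hle.trans hlen.le) bot_le

/-- A meromorphic order ignores the value at the point itself. Off `P` the coefficient is analytic,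
and then order zero does mean a nonzero value. -/
lemma coeff_ne_zero_of_order_eq_zero (q : CubicDifferential R P) {x : X} (hx : x ∉ P)
    (h : q.order x = 0) : q.coeff (R.chart x) (R.chart x x) ≠ 0 := by
  have hs := R.mem_chart_source x
  have ha := q.holomorphic _ (R.chart_mem x) _ ((R.chart x).map_source hs)
    (by rwa [(R.chart x).left_inv hs])
  rw [order, ha.meromorphicOrderAt_eq] at h
  rw [← ha.analyticOrderAt_eq_zero]
  revert h
  cases analyticOrderAt (q.coeff (R.chart x)) (R.chart x x) with
  | top => simp
  | coe n => simp

lemma flatMetric_smul {E : Type*} [NormedAddCommGroup E] [NormedSpace ℝ E]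
    (q : CubicDifferential R P) (g : E → X) (e v : E) (t : ℝ) :
    q.flatMetric g e (t • v) = t ^ 2 * q.flatMetric g e v := by
  simp only [flatMetric, map_smul, norm_smul, mul_pow, Real.norm_eq_abs, sq_abs]
  ring

/-- In the coordinates of a complex chart the flat metric is `|q|^(2/3) |dz|²`. -/
lemma flatMetric_trans_chart {S : Type*} [TopologicalSpace S] (q : CubicDifferential R P)
    (ι : OpenPartialHomeomorph S X) (hι : ι.target ⊆ Pᶜ) {φ : OpenPartialHomeomorph X ℂ}
    (hφ : φ ∈ R.charts) {e : ℂ} (he : e ∈ (ι.trans φ).target) (v : ℂ) :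
    q.flatMetric (ι ∘ (ι.trans φ).symm) e v = ‖q.coeff φ e‖ ^ (2 / 3 : ℝ) * ‖v‖ ^ 2 := by
  have hval : ∀ y ∈ (ι.trans φ).target, (ι ∘ (ι.trans φ).symm) y = φ.symm y := by
    intro y hy
    rw [OpenPartialHomeomorph.trans_target] at hy
    simpa using ι.right_inv hy.2
  have hval' : ∀ y ∈ (ι.trans φ).target, φ ((ι ∘ (ι.trans φ).symm) y) = y := by
    intro y hy
    rw [hval y hy]
    rw [OpenPartialHomeomorph.trans_target] at hy
    exact φ.right_inv hy.1
  have hn : (ι.trans φ).target ∈ 𝓝 e := (ι.trans φ).open_target.mem_nhds he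
  have hid : φ ∘ (ι ∘ (ι.trans φ).symm) =ᶠ[𝓝 e] id := eventually_of_mem hn hval'
  have heT := he
  rw [OpenPartialHomeomorph.trans_target] at heT
  have hcont : ContinuousAt (ι ∘ (ι.trans φ).symm) e :=
    (φ.symm.continuousAt heT.1).congr (EventuallyEq.symm (eventually_of_mem hn hval))
  have hs : (ι ∘ (ι.trans φ).symm) e ∈ φ.source := by
    rw [hval e he]
    exact φ.map_target heT.1
  have hP : (ι ∘ (ι.trans φ).symm) e ∉ P := by
    rw [hval e he]
    exact hι heT.2
  rw [flatMetric_eq_norm_cubicForm, q.cubicForm_eq hφ hs hP hcont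
    (differentiableAt_id.congr_of_eventuallyEq hid), hid.fderiv_eq, hval' e he, fderiv_id,
    norm_rpow_mul_sq]
  rfl

end CubicDifferential

/-- Around a point at which the limit differential has neither a zero nor a pole, the flat metrics
`|q_n|^(2/3)` are eventually bounded below by a multiple of `‖q_n‖`. -/
lemma exists_flatMetric_lower_bound {S X : Type*} [TopologicalSpace S] [ChartedSpace ℂ S]
    [TopologicalSpace X] {R : ℕ → RiemannSurfaceStructure S}
    {q : ∀ n, HolomorphicCubicDifferential (R n)} {RX : RiemannSurfaceStructure X} {P : Set X}
    {qlim : CubicDifferential RX P} {ι : OpenPartialHomeomorph S X} (hι : ι.target ⊆ Pᶜ)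
    (hconv : FlatMetricsConverge q qlim ι) (hmass : Tendsto (fun n => (q n).mass) atTop atTop)
    {φ : OpenPartialHomeomorph X ℂ} (hφ : φ ∈ RX.charts)
    (hψ : ι.trans φ ∈ IsManifold.maximalAtlas 𝓘(ℝ, ℂ) ∞ S) {e₀ : ℂ}
    (he₀ : e₀ ∈ (ι.trans φ).target) (h0 : qlim.coeff φ e₀ ≠ 0) :
    ∃ a r : ℝ, 0 < a ∧ 0 < r ∧ Metric.ball e₀ r ⊆ (ι.trans φ).target ∧
      ∀ᶠ n in atTop, ∀ e ∈ Metric.ball e₀ r, ∀ v,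
        a * (q n).mass * ‖v‖ ^ 2 ≤ (q n).flatMetric (ι.trans φ).symm e v := by
  set ψ := ι.trans φ with hψdef
  have heT := he₀
  rw [hψdef, OpenPartialHomeomorph.trans_target] at heT
  have hc : ContinuousAt (fun e => ‖qlim.coeff φ e‖ ^ (2 / 3 : ℝ)) e₀ :=
    (qlim.holomorphic φ hφ e₀ heT.1 (hι heT.2)).continuousAt.norm.rpow_const
      (Or.inr (by norm_num))
  have hpos : 0 < ‖qlim.coeff φ e₀‖ ^ (2 / 3 : ℝ) := Real.rpow_pos_of_pos (norm_pos_iff.2 h0) _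
  set b := ‖qlim.coeff φ e₀‖ ^ (2 / 3 : ℝ) with hb
  have hev : ∀ᶠ e in 𝓝 e₀, e ∈ ψ.target ∧ b / 2 < ‖qlim.coeff φ e‖ ^ (2 / 3 : ℝ) :=
    Filter.Eventually.and (ψ.open_target.mem_nhds he₀)
      (hc.eventually (lt_mem_nhds (half_lt_self hpos)))
  obtain ⟨r, hr, hball⟩ := Metric.nhds_basis_closedBall.eventually_iff.1 hev
  refine ⟨b / 4, r, by positivity, hr, fun e he =>
    (hball (Metric.ball_subset_closedBall he)).1, ?_⟩
  set K := ψ.symm '' Metric.closedBall e₀ r with hK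
  have hKc : IsCompact K := (isCompact_closedBall e₀ r).image_of_continuousOn
    (ψ.symm.continuousOn.mono fun e he => (hball he).1)
  have hKs : K ⊆ ψ.source ∩ ι.source := by
    rintro _ ⟨e, he, rfl⟩
    have := ψ.map_target (hball he).1
    exact ⟨this, (show ψ.symm e ∈ (ι.trans φ).source from this).1⟩
  have hunif := Metric.tendstoUniformlyOn_iff.1 (hconv ψ hψ K hKc hKs) (b / 4) (by positivity)
  filter_upwards [hunif, hmass.eventually_gt_atTop 0] with n hn hm e he v
  have heb := hball (Metric.ball_subset_closedBall he)
  have hunit : ∀ v : ℂ, ‖v‖ = 1 → b / 4 * (q n).mass ≤ (q n).flatMetric ψ.symm e v := by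
    intro v hv
    have h1 := hn (ψ.symm e, v) ⟨⟨e, Metric.ball_subset_closedBall he, rfl⟩, by simp [hv]⟩
    simp only [ψ.right_inv heb.1] at h1
    rw [qlim.flatMetric_trans_chart ι hι hφ heb.1, hv, one_pow, mul_one, Real.dist_eq] at h1
    have h2 := (abs_lt.1 h1).2
    have h3 : b / 4 < (q n).flatMetric ψ.symm e v / (q n).mass := by
      have := heb.2
      linarith
    exact ((lt_div_iff₀ hm).1 h3).le
  rcases eq_or_ne v 0 with rfl | hv
  · have := (q n).flatMetric_smul ψ.symm e 0 0
    simp at this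
    simp [this]
  · have hv' : ‖v‖ ≠ 0 := norm_ne_zero_iff.2 hv
    -- Convergence is uniform only over vectors of length at most one; homogeneity of degree two
    -- covers the others.
    have h1 := hunit (‖v‖⁻¹ • v) (by simp [hv'])
    have h2 := (q n).flatMetric_smul ψ.symm e (‖v‖⁻¹ • v) ‖v‖
    rw [smul_inv_smul₀ hv'] at h2
    rw [h2, mul_comm]
    gcongr

end Limit

/-- `S` is a closed smooth surface; the complex structures `R n`, their hyperbolic metrics `σ n`, the
cubic differentials `q n` and the Blaschke metrics `e^(u n) σ n` vary with `n`. The subsurface is the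
open set `ι.source`, identified by `ι` with the compact Riemann surface `X` minus a finite set `P` of
punctures, and `qlim` is the limiting differential, with poles at most at the punctures. -/
theorem mainTheorem10
    {S : Type*} [TopologicalSpace S] [T2Space S] [CompactSpace S] [ConnectedSpace S]
    [ChartedSpace ℂ S] [IsManifold 𝓘(ℝ, ℂ) ∞ S]
    (R : ℕ → RiemannSurfaceStructure S) (hR : ∀ n, (R n).IsCompatible)
    (σ : ∀ n, HyperbolicMetric (R n))
    (q : ∀ n, HolomorphicCubicDifferential (R n))
    (u : ℕ → S → ℝ) (hu : ∀ n, IsBlaschke (q n) (σ n) (u n))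
    {X : Type*} [TopologicalSpace X] [T2Space X] [CompactSpace X]
    (RX : RiemannSurfaceStructure X) (P : Set X) (hP : P.Finite)
    (ι : OpenPartialHomeomorph S X) (hι : ι.target = Pᶜ)
    (hιsmooth : ∀ φ ∈ RX.charts, ι.trans φ ∈ IsManifold.maximalAtlas 𝓘(ℝ, ℂ) ∞ S)
    (qlim : CubicDifferential RX P) (harea : qlim.area ≠ ⊤)
    (hconv : FlatMetricsConverge q qlim ι)
    (hmass : Tendsto (fun n => (q n).mass) atTop atTop)
    (ε : ℝ) (hε : 0 < ε) (p : S) (hp : p ∈ ι.source)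
    (hdist : ∀ z : X, qlim.order z ≠ 0 → ENNReal.ofReal ε ≤ qlim.flatDist (ι p) z) :
    ∃ (n₀ : ℕ) (B : ℝ) (d : ℕ → ℝ), 0 < B ∧ Tendsto d atTop atTop ∧
      (∃ c : ℝ, 0 < c ∧ ∀ n ≥ n₀, c * √((q n).mass) ≤ d n) ∧
      ∀ n ≥ n₀, logDensityDifference (q n) (σ n) (u n) p ≤ B / Real.cosh (d n / 2) := by
  -- The point `ι p` is at distance `0 < ε` from itself, so it is neither a zero nor a pole.
  have horder : qlim.order (ι p) = 0 := by
    by_contra h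
    have := hdist _ h
    rw [qlim.flatDist_self, nonpos_iff_eq_zero, ENNReal.ofReal_eq_zero] at this
    linarith
  have hιP : ι p ∉ P := by
    have := ι.map_source hp
    rwa [hι] at this
  have h0 := qlim.coeff_ne_zero_of_order_eq_zero hιP horder
  have hs := RX.mem_chart_source (ι p)
  have hφ := RX.chart_mem (ι p)
  set φ := RX.chart (ι p)
  have hψ := hιsmooth φ hφ
  have hpψ : p ∈ (ι.trans φ).source := by simp [hp, hs]
  have hpe : (ι.trans φ).symm (φ (ι p)) = p := (ι.trans φ).left_inv hpψ
  obtain ⟨a, r, ha, hr, hball, hlow⟩ := exists_flatMetric_lower_bound hι.le hconv hmass hφ hψ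
    ((ι.trans φ).map_source hpψ) h0
  have hc : 0 < √a * (r / 2) := by positivity
  have hd : Tendsto (fun n => √a * (r / 2) * √((q n).mass)) atTop atTop :=
    (Real.tendsto_sqrt_atTop.comp hmass).const_mul_atTop hc
  obtain ⟨n₀, hn₀⟩ := eventually_atTop.1
    ((hlow.and (hmass.eventually_gt_atTop 0)).and (hd.eventually_ge_atTop 2))
  -- Here `d n / 2` is the half side `ρ` of the flat square. The condition `d n ≥ 2` is the `ρ ≥ 1`
  -- needed by `cothBarrier_le`, and `12 = 6 · 2` combines the constants of the two estimates, as
  -- `cosh ρ ≤ e^ρ`.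
  refine ⟨n₀, 12, fun n => √a * (r / 2) * √((q n).mass), by norm_num, hd,
    ⟨_, hc, fun n _ => le_rfl⟩, fun n hn => ?_⟩
  obtain ⟨⟨hn1, hm⟩, hn2⟩ := hn₀ n hn
  have hκ : 0 < √(a * (q n).mass) := Real.sqrt_pos.2 (mul_pos ha hm)
  have hest := (hu n).logDensityDifference_le (hR n) hψ (r := r / 2) (r' := r) (by positivity)
    (by linarith) hκ hball (fun e he v => by
      rw [Real.sq_sqrt (mul_pos ha hm).le]
      exact hn1 e he v)
  change logDensityDifference (q n) (σ n) (u n) ((ι.trans φ).symm (φ (ι p))) ≤ _ at hest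
  have hρ : √(a * (q n).mass) * (r / 2) / 2 = √a * (r / 2) * √((q n).mass) / 2 := by
    rw [Real.sqrt_mul ha.le]
    ring
  rw [hpe, hρ] at hest
  set ρ := √a * (r / 2) * √((q n).mass) / 2 with hρdef
  have hρ1 : 1 ≤ ρ := by
    rw [hρdef]
    linarith
  have hb := cothBarrier_le hρ1
  have hcosh : Real.cosh ρ ≤ Real.exp ρ := by
    rw [← Real.cosh_add_sinh]
    have : 0 ≤ Real.sinh ρ := Real.sinh_nonneg_iff.2 (by linarith)
    linarith
  rw [le_div_iff₀ (Real.cosh_pos _)]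
  calc logDensityDifference (q n) (σ n) (u n) p * Real.cosh ρ
      ≤ (12 * Real.exp (-ρ)) * Real.cosh ρ := by
        have := Real.cosh_pos ρ
        gcongr
        linarith
    _ ≤ 12 * Real.exp (-ρ) * Real.exp ρ := by gcongr
    _ = 12 := by rw [mul_assoc, ← Real.exp_add]; simp
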